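/- There is a randomized algorithm $\operatorname{Optimize}$ with the following property. Let $m,n,k$ be non-negative integers with $n\ge 2$ and $m\le n^2$. On input - a matrix $A\in\mathbb R^{m\times n}$ with $\max_{i,j}|A_{ij}|\le 1$, each of whose columns has at most $k$ nonzero entries, - $\rho_0\ge 0$ and $\rho_+,\rho_-\in(\mathbb R^{\ge 0})^m$ with $\rho_0+\|\rho_+\|_1+\|\rho_-\|_1=1$, - a vector $v\in\mathbb R^n$ with $\|v\|_2\le 2\sqrt n$, - a number $\delta\in(0,1)$, $\operatorname{Optimize}(A,\rho_0,\rho_+,\rho_-,v,\delta)$ runs in time $\tilde O(kn+n^2)$, that is, in at most $C\,(kn+n^2)(\log n)^{c}$ steps with absolute constants $C,c$, and with probability at least $1-1/n$ it outputs a point $x'\in[-1,1]^n$ such that $$-\frac{\rho_0 v^Tx'}{\sqrt n}+\rho_+^TAx'-\rho_-^TAx'+\delta\|Ax'\|_\infty\;\le\;\min_{x\in[-1,1]^n}\Bigl(-\frac{\rho_0 v^Tx}{\sqrt n}+\rho_+^TAx-\rho_-^TAx+\delta\|Ax\|_\infty\Bigr)+\frac{\sqrt n}{(\log n)^4}.$$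 Here an algorithm is one fixed program, with natural number constants only, for a real RAM with exact arithmetic ($+,-,\times,\div$ and comparison of reals, one step each) on integers of $O(\log n)$ bits and on reals, which can toss a coin of any bias that it has computed. The matrix $A$ is given column by column through the lists of its nonzero entries. The time bound holds for all outcomes of the coin tosses. -/

import Mathlib

open scoped Matrix

noncomputable section

/-! # Randomized real RAM

Algorithms are structured programs over a randomized real RAM with exact arithmetic.  A program has
finitely many natural number variables, real variables, arrays of natural numbers and arrays of real
numbers.  Arrays are accessed at an index held in a natural number variable.  Every elementary
operation, every test and every coin toss takes one step.  There is no operation that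
turns a real number into an integer: real numbers influence integers and the flow of control
only through comparisons and coin tosses. -/

namespace RealRAM

/-- The memory: variables and arrays are named by natural numbers (constants of the program). -/
@[ext]
structure State where
  /-- natural number variables -/
  nat : ℕ → ℕ
  /-- real variables -/
  real : ℕ → ℝ
  /-- arrays of natural numbers: `natArr a i` is entry `i` of array `a` -/
  natArr : ℕ → ℕ → ℕ
  /-- arrays of real numbers: `realArr a i` is entry `i` of array `a` -/
  realArr : ℕ → ℕ → ℝ

namespace State

/-- Assign `x` to the natural number variable `d`. -/
def setNat (s : State) (d x : ℕ) : State :=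
  { s with nat := Function.update s.nat d x }

/-- Assign `x` to the real variable `d`. -/
def setReal (s : State) (d : ℕ) (x : ℝ) : State :=
  { s with real := Function.update s.real d x }

/-- Assign `x` to entry `i` of the array `a` of natural numbers. -/
def setNatArr (s : State) (a i x : ℕ) : State :=
  { s with natArr := Function.update s.natArr a (Function.update (s.natArr a) i x) }

/-- Assign `x` to entry `i` of the array `a` of real numbers. -/
def setRealArr (s : State) (a i : ℕ) (x : ℝ) : State :=
  { s with realArr := Function.update s.realArr a (Function.update (s.realArr a) i x) }

/-- All integers in the memory are at most `B`, so that each fits into a word of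
`O(log B)` bits. -/
def WordsLE (s : State) (B : ℕ) : Prop :=
  (∀ a, s.nat a ≤ B) ∧ ∀ a i, s.natArr a i ≤ B

end State

/-- Elementary operations.  The first argument of the arithmetic and load operations names
the target variable. -/
inductive Op where
  | skip
  | natConst (d c : ℕ)
  | natAdd (d a b : ℕ)
  | natSub (d a b : ℕ)
  | natMul (d a b : ℕ)
  | natDiv (d a b : ℕ)
  | natLoad (d arr idx : ℕ)
  | natStore (arr idx a : ℕ)
  | realOfNat (d a : ℕ)
  | realAdd (d a b : ℕ)
  | realSub (d a b : ℕ)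
  | realMul (d a b : ℕ)
  | realDiv (d a b : ℕ)
  | realLoad (d arr idx : ℕ)
  | realStore (arr idx a : ℕ)

/-- The effect of an elementary operation.  Subtraction of natural numbers is truncated, division
of natural numbers rounds down, and division by zero gives zero. -/
def Op.exec : Op → State → State
  | skip, s => s
  | natConst d c, s => s.setNat d c
  | natAdd d a b, s => s.setNat d (s.nat a + s.nat b)
  | natSub d a b, s => s.setNat d (s.nat a - s.nat b)
  | natMul d a b, s => s.setNat d (s.nat a * s.nat b)
  | natDiv d a b, s => s.setNat d (s.nat a / s.nat b)
  | natLoad d arr idx, s => s.setNat d (s.natArr arr (s.nat idx))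
  | natStore arr idx a, s => s.setNatArr arr (s.nat idx) (s.nat a)
  | realOfNat d a, s => s.setReal d (s.nat a : ℝ)
  | realAdd d a b, s => s.setReal d (s.real a + s.real b)
  | realSub d a b, s => s.setReal d (s.real a - s.real b)
  | realMul d a b, s => s.setReal d (s.real a * s.real b)
  | realDiv d a b, s => s.setReal d (s.real a / s.real b)
  | realLoad d arr idx, s => s.setReal d (s.realArr arr (s.nat idx))
  | realStore arr idx a, s => s.setRealArr arr (s.nat idx) (s.real a)

/-- Tests: comparisons of two variables. -/
inductive Test where
  | natLT (a b : ℕ)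
  | natEQ (a b : ℕ)
  | realLT (a b : ℕ)

/-- The truth value of a test. -/
def Test.Holds : Test → State → Prop
  | natLT a b, s => s.nat a < s.nat b
  | natEQ a b, s => s.nat a = s.nat b
  | realLT a b, s => s.real a < s.real b

/-- Programs.  `coin d r` tosses a coin whose bias is the value of the real variable `r` and
stores the result, `1` or `0`, in the natural number variable `d`. -/
inductive Program where
  | op (o : Op)
  | coin (d r : ℕ)
  | seq (p q : Program)
  | ite (t : Test) (p q : Program)
  | loop (t : Test) (p : Program)

/-- A configuration: the parts of the program that remain to be executed, and the memory. -/
abbrev Config := List Program × State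

/-- A coin that shows `true` with probability `r`, where `r` is clipped to `[0, 1]`. -/
def toss (r : ℝ) : PMF Bool :=
  PMF.ofFintype (fun b => cond b (min (ENNReal.ofReal r) 1) (1 - min (ENNReal.ofReal r) 1))
    (by simp)

open Classical in
/-- One step of the execution. A configuration with nothing left to execute has halted and does not
change any more. -/
def step : Config → PMF Config
  | ([], s) => PMF.pure ([], s)
  | (.op o :: K, s) => PMF.pure (K, o.exec s)
  | (.coin d r :: K, s) => (toss (s.real r)).map fun b => (K, s.setNat d (if b then 1 else 0))
  | (.seq p q :: K, s) => PMF.pure (p :: q :: K, s)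
  | (.ite t p q :: K, s) => PMF.pure ((if t.Holds s then p else q) :: K, s)
  | (.loop t p :: K, s) => PMF.pure (if t.Holds s then p :: .loop t p :: K else K, s)

/-- The distribution of the configuration after `t` steps. -/
def run : ℕ → Config → PMF Config
  | 0, c => PMF.pure c
  | t + 1, c => (step c).bind (run t)

/-- Started in the memory `s`, the program `P` has halted after at most `T` steps, whatever the
outcomes of the coin tosses. -/
def HaltsWithin (P : Program) (s : State) (T : ℕ) : Prop :=
  ∀ c ∈ (run T ([P], s)).support, c.1 = []

/-- Started in the memory `s`, the program `P` never holds an integer larger than `B`,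
whatever the outcomes of the coin tosses. -/
def UsesWordsLE (P : Program) (s : State) (B : ℕ) : Prop :=
  ∀ t, ∀ c ∈ (run t ([P], s)).support, c.2.WordsLE B

/-- The probability that, after `T` steps from the memory `s`, the program `P` has halted
with its memory satisfying `E`. -/
def haltProb (P : Program) (s : State) (T : ℕ) (E : State → Prop) : ENNReal :=
  (run T ([P], s)).toOuterMeasure {c | c.1 = [] ∧ E c.2}

end RealRAM

/-! # Sparse matrices and the optimization problem -/

namespace SparseMatrix

variable {m n : ℕ}

open Classical in
/-- The positions of the nonzero entries of `A`, column after column, and from top to bottom within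
each column. -/
def nonzeros (A : Matrix (Fin m) (Fin n) ℝ) : List (Fin m × Fin n) :=
  (List.finRange n).flatMap fun j =>
    ((List.finRange m).filter fun i => A i j ≠ 0).map fun i => (i, j)

/-- The number of nonzero entries in the columns before column `j`. -/
def columnStart (A : Matrix (Fin m) (Fin n) ℝ) (j : ℕ) : ℕ :=
  ((nonzeros A).filter fun e => (e.2 : ℕ) < j).length

/-- The row of the nonzero entry number `p` (and `0` if there are at most `p` nonzero entries). -/
def rowIndex (A : Matrix (Fin m) (Fin n) ℝ) (p : ℕ) : ℕ :=
  ((nonzeros A)[p]?).elim 0 fun e => (e.1 : ℕ)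

/-- The value of the nonzero entry number `p` (and `0` if there are at most `p` such entries). -/
def value (A : Matrix (Fin m) (Fin n) ℝ) (p : ℕ) : ℝ :=
  ((nonzeros A)[p]?).elim 0 fun e => A e.1 e.2

end SparseMatrix

namespace PenalizedOptimization

variable {m n : ℕ}

/-- The objective `-ρ₀ vᵀx / √n + ρ₊ᵀ A x - ρ₋ᵀ A x + δ ‖A x‖_∞`; the norm on `Fin m → ℝ` is
the sup norm. -/
def objective (A : Matrix (Fin m) (Fin n) ℝ) (ρ₀ : ℝ) (ρp ρm : Fin m → ℝ)
    (v : EuclideanSpace ℝ (Fin n)) (δ : ℝ) (x : Fin n → ℝ) : ℝ :=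
  -ρ₀ * (v.ofLp ⬝ᵥ x) / √(n : ℝ) + ρp ⬝ᵥ (A *ᵥ x) - ρm ⬝ᵥ (A *ᵥ x) + δ * ‖A *ᵥ x‖

/-- The cube `[-1, 1]ⁿ`. -/
def cube (n : ℕ) : Set (Fin n → ℝ) := {x | ∀ j, x j ∈ Set.Icc (-1 : ℝ) 1}

/-- A finite vector as an array, padded by zeros. -/
def toArray (x : Fin n → ℝ) (i : ℕ) : ℝ := if h : i < n then x ⟨i, h⟩ else 0

/-- The memory that holds the input.  The variables hold the dimensions and the scalars; the matrix
is given in compressed sparse column format, so that the nonzero entries of column `j` are the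
entries number `p` with `columnStart A j ≤ p < columnStart A (j + 1)`.  The rest is zero. -/
def input (A : Matrix (Fin m) (Fin n) ℝ) (ρ₀ : ℝ) (ρp ρm : Fin m → ℝ)
    (v : EuclideanSpace ℝ (Fin n)) (δ : ℝ) : RealRAM.State where
  nat
    | 0 => n
    | 1 => m
    | _ => 0
  real
    | 0 => ρ₀
    | 1 => δ
    | _ => 0
  natArr
    | 0 => SparseMatrix.columnStart A
    | 1 => SparseMatrix.rowIndex A
    | _ => fun _ => 0
  realArr
    | 0 => toArray v.ofLp
    | 1 => toArray ρp
    | 2 => toArray ρm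
    | 3 => SparseMatrix.value A
    | _ => fun _ => 0

/-- The output: the first `n` entries of real array number `4`. -/
def output (n : ℕ) (s : RealRAM.State) : Fin n → ℝ := fun j => s.realArr 4 j

end PenalizedOptimization

end

/-! Write `L` for the binary length of `n` and `q = √n`. The sup norm is smoothed into a
log-sum-exp: with `β` of order `L ^ 5 / q`, `soft` is the linear part `g ⬝ᵥ x` plus `δ / β` times
the logarithm of `partition`. Since `m ≤ n ^ 2`, smoothing costs `O(L / β)`, which is of order `q /
L ^ 4` (`norm_le_soft`, `soft_le_norm`). The smoothed function `F` is convex (`soft_ge`), and moving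
one coordinate by `d` costs at most `δ β d ^ 2` beyond the linear term (`soft_update_le`).

The algorithm is a randomized coordinate version of Frank-Wolfe. It starts at `0`, picks a uniform
coordinate `j`, and moves `x j` by the fraction `α` of the way to the endpoint of `[-1, 1]` that
opposes the sign of the `j`-th partial derivative. These endpoints together minimize the
linearization over the cube, so by convexity the excess `F x - F y` over a minimizer `y` of the
objective shrinks on average by the factor `1 - α / n`, up to a small additive error absorbed in a
level `C`.

High probability comes from exponential moments rather than expectations. For `0 ≤ θ ≤ l` one step
gives `E exp (θ (F x' - F y - C)) ≤ exp (θ (1 - α / n) (F x - F y - C))` (`sum_exp_update_le`).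
Chaining this with `θ = l (1 - α / n) ^ r`, where `r` is the number of steps still to come, and
applying Markov's inequality at the end bounds the failure probability (`loop_halts`). The chosen
parameters make it at most `exp (-L) ≤ 1 / n` (`success_probability`).

The image `A x` and the partition function are maintained, so a step touches only the at most `k`
entries of one column. Exponentials are replaced by `(1 + u / 2 ^ S) ^ 2 ^ S` with `S = 64 L`
squarings. This perturbs slopes so little that a wrong sign is chosen only where the slope is
negligible (`slope_sign`). A step costs `O(n + k L)`, sampling `j` taking `O(n)`, and there are `O(n
L ^ 10)` steps.

Program correctness is expressed by `Halts`, which bounds time, word size and success probability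
together. Deterministic code is handled by `Ensures`, which quantifies over all continuations, so it
passes any probability bound of the remaining program through unchanged. -/

namespace RealRAM

/-! ### Executions, halting and success probabilities. -/

theorem run_succ_eq_bind_step (T : ℕ) (c : Config) : run (T + 1) c = (run T c).bind step := by
  induction T generalizing c with
  | zero => simp [run]
  | succ T ih =>
    rw [run, run, PMF.bind_bind]
    congr 1
    funext c'
    exact ih c'

/-- Halted configurations are fixed by `step`, so further steps change nothing. This is what allows
time bounds to be relaxed in `Halts.mono`. -/
theorem run_succ_of_halted {T : ℕ} {c : Config} (h : ∀ c' ∈ (run T c).support, c'.1 = []) :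
    run (T + 1) c = run T c := by
  rw [run_succ_eq_bind_step]
  ext c'
  rw [PMF.bind_apply]
  conv_rhs => rw [← PMF.bind_pure (run T c), PMF.bind_apply]
  refine tsum_congr fun a => ?_
  by_cases ha : run T c a = 0
  · simp [ha]
  · obtain ⟨K, s⟩ := a
    have := h (K, s) ((PMF.mem_support_iff _ _).2 ha)
    simp only at this
    subst this
    rfl

/-- From the configuration `c` the execution halts within `T` steps, holds no integers above `B`,
and ends in a memory satisfying `E` with probability at least `x`. -/
structure Halts (B : ℕ) (E : State → Prop) (c : Config) (T : ℕ) (x : ℝ) : Prop where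
  halt : ∀ c' ∈ (run T c).support, c'.1 = []
  words : ∀ t, ∀ c' ∈ (run t c).support, c'.2.WordsLE B
  prob : ENNReal.ofReal x ≤ (run T c).toOuterMeasure {c' | c'.1 = [] ∧ E c'.2}

namespace Halts

variable {B : ℕ} {E : State → Prop} {c c' : Config} {s : State} {T T' : ℕ} {x x' : ℝ}

theorem succ (h : Halts B E c T x) : Halts B E c (T + 1) x := by
  have e := run_succ_of_halted h.halt
  exact ⟨e ▸ h.halt, h.words, e ▸ h.prob⟩

theorem mono (h : Halts B E c T x) (hT : T ≤ T') (hx : x' ≤ x) : Halts B E c T' x' := by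
  induction hT with
  | refl => exact ⟨h.halt, h.words, (ENNReal.ofReal_le_ofReal hx).trans h.prob⟩
  | step _ ih => exact ih.succ

theorem run_nil (t : ℕ) (s : State) : run t ([], s) = PMF.pure ([], s) := by
  induction t with
  | zero => rfl
  | succ t ih => rw [run, step, PMF.pure_bind, ih]

/-- A nonpositive bound demands nothing, so `E` is needed only when `0 < x`. Markov's inequality
enters `loop_halts` through this case distinction. -/
theorem nil (hw : s.WordsLE B) (hE : 0 < x → E s) (hx : x ≤ 1) : Halts B E ([], s) 0 x := by
  refine ⟨fun c' hc => ?_, fun t c' hc => ?_, ?_⟩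
  · rw [run_nil, PMF.mem_support_pure_iff] at hc
    simp [hc]
  · rw [run_nil, PMF.mem_support_pure_iff] at hc
    simpa [hc] using hw
  · by_cases h : 0 < x
    · rw [run_nil, PMF.toOuterMeasure_pure_apply, if_pos ⟨rfl, hE h⟩]
      exact ENNReal.ofReal_le_one.2 hx
    · rw [ENNReal.ofReal_of_nonpos (not_lt.1 h)]
      exact zero_le

theorem of_step_eq_pure (hs : step c = PMF.pure c') (hw : c.2.WordsLE B)
    (h : Halts B E c' T x) : Halts B E c (T + 1) x := by
  have e : ∀ t, run (t + 1) c = run t c' := fun t => by rw [run, hs, PMF.pure_bind]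
  refine ⟨by rw [e]; exact h.halt, fun t => ?_, by rw [e]; exact h.prob⟩
  cases t with
  | zero => intro a ha; rw [run, PMF.mem_support_pure_iff] at ha; exact ha ▸ hw
  | succ t => rw [e]; exact h.words t

theorem coin {d a : ℕ} {K : List Program} {x₁ x₀ : ℝ} (hw : s.WordsLE B)
    (h0 : 0 ≤ s.real a) (h1 : s.real a ≤ 1)
    (ht : Halts B E (K, s.setNat d 1) T x₁) (hf : Halts B E (K, s.setNat d 0) T x₀) :
    Halts B E (.coin d a :: K, s) (T + 1) (s.real a * x₁ + (1 - s.real a) * x₀) := by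
  have e : ∀ t, run (t + 1) (.coin d a :: K, s) =
      (toss (s.real a)).bind fun b => run t (K, s.setNat d (if b then 1 else 0)) := fun t => by
    rw [run, step, PMF.bind_map]; rfl
  refine ⟨fun c' hc => ?_, fun t c' hc => ?_, ?_⟩
  · rw [e, PMF.mem_support_bind_iff] at hc
    obtain ⟨b, -, hb⟩ := hc
    cases b
    · exact hf.halt c' (by simpa using hb)
    · exact ht.halt c' (by simpa using hb)
  · cases t with
    | zero => rw [run, PMF.mem_support_pure_iff] at hc; exact hc ▸ hw
    | succ t =>
      rw [e, PMF.mem_support_bind_iff] at hc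
      obtain ⟨b, -, hb⟩ := hc
      cases b
      · exact hf.words t c' (by simpa using hb)
      · exact ht.words t c' (by simpa using hb)
  · rw [e, PMF.toOuterMeasure_bind_apply, tsum_bool]
    have hr : min (ENNReal.ofReal (s.real a)) 1 = ENNReal.ofReal (s.real a) :=
      min_eq_left (ENNReal.ofReal_le_one.2 h1)
    have hr' : 1 - ENNReal.ofReal (s.real a) = ENNReal.ofReal (1 - s.real a) := by
      rw [ENNReal.ofReal_sub _ h0, ENNReal.ofReal_one]
    have t1 : toss (s.real a) true = ENNReal.ofReal (s.real a) := by
      simp [toss, PMF.ofFintype_apply, hr]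
    have t0 : toss (s.real a) false = ENNReal.ofReal (1 - s.real a) := by
      simp [toss, PMF.ofFintype_apply, hr, hr']
    rw [t1, t0, add_comm (s.real a * x₁)]
    -- Subadditivity is the right tool: `x₁` and `x₀` may be negative, so equality can fail.
    refine ENNReal.ofReal_add_le.trans ?_
    rw [ENNReal.ofReal_mul h0, ENNReal.ofReal_mul (sub_nonneg.2 h1)]
    refine add_le_add (mul_le_mul' le_rfl ?_) (mul_le_mul' le_rfl ?_)
    · simpa using hf.prob
    · simpa using ht.prob

end Halts

/-! ### A program logic for deterministic code. -/

/-- Hoare triples with time bounds: started in the memory `s`, the program `p` ends within `T` steps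
in a memory satisfying `Q`, without exceeding the word bound `B`. -/
def Ensures (B : ℕ) (p : Program) (s : State) (T : ℕ) (Q : State → Prop) : Prop :=
  ∀ (E : State → Prop) (K : List Program) (T' : ℕ) (x : ℝ),
    (∀ s', s'.WordsLE B → Q s' → Halts B E (K, s') T' x) → Halts B E (p :: K, s) (T + T') x

/-- The assignments of `o` do not exceed `B`. -/
def Op.Fits (B : ℕ) : Op → State → Prop
  | natConst _ c, _ => c ≤ B
  | natAdd _ a b, s => s.nat a + s.nat b ≤ B
  | natMul _ a b, s => s.nat a * s.nat b ≤ B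
  | _, _ => True

theorem State.WordsLE.exec {B : ℕ} {s : State} {o : Op} (h : s.WordsLE B) (ho : o.Fits B s) :
    (o.exec s).WordsLE B := by
  have key : ∀ d x, x ≤ B → (s.setNat d x).WordsLE B := fun d x hx => by
    refine ⟨fun a => ?_, h.2⟩
    by_cases had : a = d
    · subst had; simpa [State.setNat] using hx
    · simpa [State.setNat, had] using h.1 a
  cases o with
  | skip => exact h
  | natConst d c => exact key _ _ ho
  | natAdd d a b => exact key _ _ ho
  | natSub d a b => exact key _ _ ((Nat.sub_le _ _).trans (h.1 a))
  | natMul d a b => exact key _ _ ho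
  | natDiv d a b => exact key _ _ ((Nat.div_le_self _ _).trans (h.1 a))
  | natLoad d arr idx => exact key _ _ (h.2 _ _)
  | natStore arr idx a =>
    refine ⟨h.1, fun b i => ?_⟩
    simp only [Op.exec, State.setNatArr]
    by_cases hb : b = arr
    · subst hb
      rw [Function.update_self]
      by_cases hi : i = s.nat idx
      · subst hi; simpa using h.1 a
      · rw [Function.update_of_ne hi]; exact h.2 _ _
    · rw [Function.update_of_ne hb]; exact h.2 _ _
  | realOfNat | realAdd | realSub | realMul | realDiv | realLoad | realStore => exact h

/-- Straight-line code. -/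
def block : List Op → Program
  | [] => .op .skip
  | o :: l => .seq (.op o) (block l)

/-- The effect of straight-line code. -/
noncomputable def execs : List Op → State → State
  | [], s => s
  | o :: l, s => execs l (o.exec s)

/-- No assignment in a straight-line program exceeds `B`. -/
def FitAll (B : ℕ) : List Op → State → Prop
  | [], _ => True
  | o :: l, s => o.Fits B s ∧ FitAll B l (o.exec s)

namespace Ensures

variable {B : ℕ} {p q : Program} {s : State} {T T₁ T₂ : ℕ} {Q R : State → Prop}

theorem mono (h : Ensures B p s T₁ Q) (hT : T₁ ≤ T) (hQ : ∀ s', s'.WordsLE B → Q s' → R s') :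
    Ensures B p s T R := fun E K T' x hK =>
  (h E K T' x fun s' hw hs => hK s' hw (hQ s' hw hs)).mono (by omega) le_rfl

theorem le (h : Ensures B p s T₁ Q) (hT : T₁ ≤ T) : Ensures B p s T Q :=
  h.mono hT fun _ _ h => h

theorem op {o : Op} (hw : s.WordsLE B) (ho : o.Fits B s) (hQ : Q (o.exec s)) :
    Ensures B (.op o) s 1 Q := fun E K T' x hK => by
  rw [add_comm]
  exact Halts.of_step_eq_pure (by rw [step]) hw (hK _ (hw.exec ho) hQ)

theorem seq (hw : s.WordsLE B) (hp : Ensures B p s T₁ R)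
    (hq : ∀ s', s'.WordsLE B → R s' → Ensures B q s' T₂ Q) :
    Ensures B (.seq p q) s (1 + T₁ + T₂) Q := fun E K T' x hK => by
  rw [show 1 + T₁ + T₂ + T' = (T₁ + (T₂ + T')) + 1 by ring]
  exact Halts.of_step_eq_pure (by rw [step]) hw
    (hp E _ _ x fun s' hw' hs' => hq s' hw' hs' E K T' x hK)

theorem ite {t : Test} (hw : s.WordsLE B) (hp : t.Holds s → Ensures B p s T Q)
    (hq : ¬ t.Holds s → Ensures B q s T Q) : Ensures B (.ite t p q) s (1 + T) Q :=
  fun E K T' x hK => by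
    rw [show 1 + T + T' = (T + T') + 1 by ring]
    by_cases ht : t.Holds s
    · exact Halts.of_step_eq_pure (by rw [step, if_pos ht]) hw (hp ht E K T' x hK)
    · exact Halts.of_step_eq_pure (by rw [step, if_neg ht]) hw (hq ht E K T' x hK)

/-- Induction on the number `r` of remaining passes. Each pass costs one test besides its body, and
the final failing test gives the last `+ 1`. -/
theorem loop {t : Test} (I : ℕ → State → Prop) (N : ℕ) (hw : s.WordsLE B) (h0 : I 0 s)
    (hbody : ∀ k < N, ∀ s, s.WordsLE B → I k s → t.Holds s ∧ Ensures B p s T (I (k + 1)))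
    (hend : ∀ s, I N s → ¬ t.Holds s) :
    Ensures B (.loop t p) s (N * (T + 1) + 1) (I N) := by
  suffices ∀ r k s, k + r = N → s.WordsLE B → I k s →
      Ensures B (.loop t p) s (r * (T + 1) + 1) (I N) from this N 0 s (zero_add N) hw h0
  intro r
  induction r with
  | zero =>
    intro k s hk hw hI E K T' x hK
    obtain rfl : k = N := by omega
    rw [show 0 * (T + 1) + 1 + T' = T' + 1 by ring]
    exact Halts.of_step_eq_pure (by rw [step, if_neg (hend s hI)]) hw (hK s hw hI)
  | succ r ih =>
    intro k s hk hw hI E K T' x hK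
    obtain ⟨ht, hb⟩ := hbody k (by omega) s hw hI
    rw [show (r + 1) * (T + 1) + 1 + T' = (T + (r * (T + 1) + 1 + T')) + 1 by ring]
    exact Halts.of_step_eq_pure (by rw [step, if_pos ht]) hw
      (hb E _ _ x fun s' hw' hI' => ih (k + 1) s' (by omega) hw' hI' E K T' x hK)

theorem block {l : List Op} (hw : s.WordsLE B) (hl : FitAll B l s) (hQ : Q (execs l s)) :
    Ensures B (block l) s (2 * l.length + 1) Q := by
  induction l generalizing s with
  | nil => exact op hw trivial hQ
  | cons o l ih =>
    refine (seq hw (op (Q := fun s' => s' = o.exec s) hw hl.1 rfl) (T₂ := 2 * l.length + 1)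
      fun s' hw' e => ?_).le (by simp only [List.length_cons]; omega)
    subst e
    exact ih hw' hl.2 hQ

end Ensures

/-! ### Frame conditions: low-numbered variables persist, higher ones are scratch space. -/

/-- The natural number variables below `L`, the real variables below `R` and the arrays of natural
numbers agree. -/
structure Frame (L R : ℕ) (s s' : State) : Prop where
  nat : ∀ a < L, s'.nat a = s.nat a
  real : ∀ a < R, s'.real a = s.real a
  natArr : s'.natArr = s.natArr

namespace Frame

variable {L R L' R' : ℕ} {s₁ s₂ s₃ : State}

@[simp] theorem refl (L R : ℕ) (s : State) : Frame L R s s := ⟨fun _ _ => rfl, fun _ _ => rfl, rfl⟩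

theorem trans (h : Frame L R s₁ s₂) (h' : Frame L R s₂ s₃) : Frame L R s₁ s₃ :=
  ⟨fun a ha => (h'.nat a ha).trans (h.nat a ha), fun a ha => (h'.real a ha).trans (h.real a ha),
    h'.natArr.trans h.natArr⟩

theorem of_le (h : Frame L R s₁ s₂) (hL : L' ≤ L := by norm_num) (hR : R' ≤ R := by norm_num) :
    Frame L' R' s₁ s₂ :=
  ⟨fun a ha => h.nat a (ha.trans_le hL), fun a ha => h.real a (ha.trans_le hR), h.natArr⟩

end Frame

namespace State

variable (s : State) (d x a i : ℕ) (y : ℝ)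

@[simp] theorem nat_setNat : (s.setNat d x).nat a = if a = d then x else s.nat a := by
  simp [setNat, Function.update_apply]

@[simp] theorem nat_setReal : (s.setReal d y).nat = s.nat := rfl

@[simp] theorem nat_setRealArr : (s.setRealArr a i y).nat = s.nat := rfl

@[simp] theorem real_setReal : (s.setReal d y).real a = if a = d then y else s.real a := by
  simp [setReal, Function.update_apply]

@[simp] theorem real_setNat : (s.setNat d x).real = s.real := rfl

@[simp] theorem real_setRealArr : (s.setRealArr a i y).real = s.real := rfl

@[simp] theorem natArr_setNat : (s.setNat d x).natArr = s.natArr := rfl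

@[simp] theorem natArr_setReal : (s.setReal d y).natArr = s.natArr := rfl

@[simp] theorem natArr_setRealArr : (s.setRealArr a i y).natArr = s.natArr := rfl

@[simp] theorem realArr_setNat : (s.setNat d x).realArr = s.realArr := rfl

@[simp] theorem realArr_setReal : (s.setReal d y).realArr = s.realArr := rfl

@[simp] theorem realArr_setRealArr (b : ℕ) : (s.setRealArr a i y).realArr b =
    if b = a then Function.update (s.realArr a) i y else s.realArr b := by
  simp [setRealArr, Function.update_apply]

end State

namespace Frame

variable {L R d x : ℕ} {y : ℝ} {s s' : State}

@[simp] theorem setNat_right (h : L ≤ d) : Frame L R s (s'.setNat d x) ↔ Frame L R s s' := by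
  refine ⟨fun H => ⟨fun a ha => ?_, H.real, H.natArr⟩, fun H => ⟨fun a ha => ?_, H.real, H.natArr⟩⟩
  · have := H.nat a ha
    rwa [State.nat_setNat, if_neg (by omega)] at this
  · rw [State.nat_setNat, if_neg (by omega)]
    exact H.nat a ha

@[simp] theorem setReal_right (h : R ≤ d) : Frame L R s (s'.setReal d y) ↔ Frame L R s s' := by
  refine ⟨fun H => ⟨H.nat, fun a ha => ?_, H.natArr⟩, fun H => ⟨H.nat, fun a ha => ?_, H.natArr⟩⟩
  · have := H.real a ha
    rwa [State.real_setReal, if_neg (by omega)] at this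
  · rw [State.real_setReal, if_neg (by omega)]
    exact H.real a ha

@[simp] theorem setRealArr_right {a i : ℕ} :
    Frame L R s (s'.setRealArr a i y) ↔ Frame L R s s' :=
  ⟨fun H => ⟨H.nat, H.real, H.natArr⟩, fun H => ⟨H.nat, H.real, H.natArr⟩⟩

end Frame

attribute [simp] execs Op.exec FitAll Op.Fits

end RealRAM

/-! ### The compressed sparse column format. -/

namespace SparseMatrix

variable {m n : ℕ}

open Classical in
/-- The nonzero entries of column `j`. -/
noncomputable def column (A : Matrix (Fin m) (Fin n) ℝ) (j : Fin n) : List (Fin m × Fin n) :=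
  ((List.finRange m).filter fun i => A i j ≠ 0).map fun i => (i, j)

theorem snd_of_mem_column {A : Matrix (Fin m) (Fin n) ℝ} {j : Fin n} {e : Fin m × Fin n}
    (h : e ∈ column A j) : e.2 = j := by
  simp only [column, List.mem_map] at h
  obtain ⟨i, -, rfl⟩ := h
  rfl

theorem flatMap_column_split (A : Matrix (Fin m) (Fin n) ℝ) (j : ℕ) (hj : j < n) :
    nonzeros A = ((List.finRange n).take j).flatMap (column A) ++
      (column A ⟨j, hj⟩ ++ ((List.finRange n).drop (j + 1)).flatMap (column A)) := by
  have h : List.finRange n = (List.finRange n).take j ++ (⟨j, hj⟩ ::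
      (List.finRange n).drop (j + 1)) := by
    conv_lhs => rw [← List.take_append_drop j (List.finRange n)]
    rw [List.drop_eq_getElem_cons (by simpa using hj)]
    simp
  have e : nonzeros A = (List.finRange n).flatMap (column A) := rfl
  rw [e]
  conv_lhs => rw [h]
  rw [List.flatMap_append, List.flatMap_cons]

/-- The list `nonzeros` is the concatenation of the columns in order, so the entries in columns
before `j` form a prefix of it. -/
theorem columnStart_eq (A : Matrix (Fin m) (Fin n) ℝ) (j : ℕ) :
    columnStart A j = (((List.finRange n).take j).flatMap (column A)).length := by
  classical
  have e : nonzeros A = ((List.finRange n).take j).flatMap (column A) ++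
      ((List.finRange n).drop j).flatMap (column A) := by
    rw [← List.flatMap_append, List.take_append_drop]; rfl
  have h1 : (((List.finRange n).take j).flatMap (column A)).filter
      (fun e => decide ((e.2 : ℕ) < j)) = ((List.finRange n).take j).flatMap (column A) := by
    refine List.filter_eq_self.2 fun a ha => ?_
    obtain ⟨b, hb, hab⟩ := List.mem_flatMap.1 ha
    obtain ⟨i, hi, rfl⟩ := List.mem_iff_getElem.1 hb
    rw [snd_of_mem_column hab]
    simp at hi ⊢
    exact hi.1
  have h2 : (((List.finRange n).drop j).flatMap (column A)).filter
      (fun e => decide ((e.2 : ℕ) < j)) = [] := by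
    refine List.filter_eq_nil_iff.2 fun a ha => ?_
    obtain ⟨b, hb, hab⟩ := List.mem_flatMap.1 ha
    obtain ⟨i, hi, rfl⟩ := List.mem_iff_getElem.1 hb
    rw [snd_of_mem_column hab]
    simp
  have : columnStart A j = ((nonzeros A).filter fun e => decide ((e.2 : ℕ) < j)).length := by
    unfold columnStart; congr!
  rw [this, e, List.filter_append, h1, h2, List.append_nil]

theorem columnStart_succ (A : Matrix (Fin m) (Fin n) ℝ) (j : Fin n) :
    columnStart A (j + 1) = columnStart A j + (column A j).length := by
  rw [columnStart_eq, columnStart_eq, List.take_add_one, List.flatMap_append]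
  simp

theorem columnStart_le (A : Matrix (Fin m) (Fin n) ℝ) (j : ℕ) : columnStart A j ≤ n * m := by
  have h : ∀ l : List (Fin n), (l.flatMap (column A)).length ≤ l.length * m := by
    intro l
    induction l with
    | nil => simp
    | cons a l ih =>
      rw [List.flatMap_cons, List.length_append, List.length_cons, add_mul, one_mul, add_comm]
      refine add_le_add ih ?_
      rw [column, List.length_map]
      exact (List.length_filter_le _ _).trans (by simp)
  rw [columnStart_eq]
  refine (h _).trans (Nat.mul_le_mul_right _ ?_)
  simp

theorem rowIndex_le (A : Matrix (Fin m) (Fin n) ℝ) (p : ℕ) : rowIndex A p ≤ m := by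
  unfold rowIndex
  cases (nonzeros A)[p]? with
  | none => simp
  | some e => simp

theorem nonzeros_getElem? (A : Matrix (Fin m) (Fin n) ℝ) (j : Fin n) (q : ℕ)
    (hq : q < (column A j).length) :
    (nonzeros A)[columnStart A j + q]? = some ((column A j)[q]) := by
  rw [flatMap_column_split A j j.2, columnStart_eq, List.getElem?_append_right (by omega),
    Nat.add_sub_cancel_left, List.getElem?_append_left hq, List.getElem?_eq_getElem hq]

theorem rowIndex_lt (A : Matrix (Fin m) (Fin n) ℝ) (j : Fin n) (q : ℕ)
    (hq : q < (column A j).length) : rowIndex A (columnStart A j + q) < m := by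
  rw [rowIndex, nonzeros_getElem? A j q hq]
  exact ((column A j)[q]).1.2

theorem column_length_le (A : Matrix (Fin m) (Fin n) ℝ) (j : Fin n) {k : ℕ}
    (hk : {i | A i j ≠ 0}.ncard ≤ k) : (column A j).length ≤ k := by
  classical
  refine le_trans (le_of_eq ?_) hk
  rw [column, List.length_map, ← List.toFinset_card_of_nodup ((List.nodup_finRange m).filter _),
    ← Set.ncard_coe_finset]
  congr 1
  ext i
  simp

/-- Sums over the stored entries of a column. -/
theorem sum_column (A : Matrix (Fin m) (Fin n) ℝ) (j : Fin n) (f : ℕ → ℝ) :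
    ∑ q ∈ Finset.range (column A j).length,
      value A (columnStart A j + q) * f (rowIndex A (columnStart A j + q)) =
      ∑ i, A i j * f i := by
  classical
  have h1 : ∑ q ∈ Finset.range (column A j).length,
      value A (columnStart A j + q) * f (rowIndex A (columnStart A j + q)) =
      ((column A j).map fun e => A e.1 e.2 * f e.1).sum := by
    rw [Finset.sum_range, ← List.sum_ofFn]
    congr 1
    apply List.ext_getElem
    · simp
    · intro q h1 h2
      have hq : q < (column A j).length := by simpa using h1
      simp [value, rowIndex, nonzeros_getElem? A j q hq]
  rw [h1, column, List.map_map, ← List.sum_toFinset _ ((List.nodup_finRange m).filter _)]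
  -- The entries that are not stored vanish and contribute nothing to the full sum.
  rw [← Finset.sum_filter_add_sum_filter_not Finset.univ (fun i => A i j ≠ 0),
    Finset.sum_eq_zero (s := Finset.filter (fun i => ¬ A i j ≠ 0) _), add_zero]
  · refine Finset.sum_congr ?_ fun _ _ => rfl
    ext i
    simp
  · intro i hi
    simp only [not_not, Finset.mem_filter] at hi
    simp [hi.2]

end SparseMatrix

/-! ### The smoothed objective: convexity and smoothness. -/

namespace PenalizedOptimization

variable {m n : ℕ}

/-- The partition function of the symmetrized softmax of `A x`, with a constant term for zero. -/
noncomputable def partition (A : Matrix (Fin m) (Fin n) ℝ) (β : ℝ) (x : Fin n → ℝ) : ℝ :=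
  1 + ∑ i, (Real.exp (β * (A *ᵥ x) i) + Real.exp (-(β * (A *ᵥ x) i)))

/-- The `j`-th partial derivative of the partition function, divided by `β`. -/
noncomputable def moment (A : Matrix (Fin m) (Fin n) ℝ) (β : ℝ) (x : Fin n → ℝ) (j : Fin n) : ℝ :=
  ∑ i, A i j * (Real.exp (β * (A *ᵥ x) i) - Real.exp (-(β * (A *ᵥ x) i)))

/-- The smoothed objective. -/
noncomputable def soft (A : Matrix (Fin m) (Fin n) ℝ) (β δ : ℝ) (g x : Fin n → ℝ) : ℝ :=
  g ⬝ᵥ x + δ / β * Real.log (partition A β x)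

/-- The partial derivatives of the smoothed objective. -/
noncomputable def slope (A : Matrix (Fin m) (Fin n) ℝ) (β δ : ℝ) (g x : Fin n → ℝ) (j : Fin n) :
    ℝ :=
  g j + δ * (moment A β x j / partition A β x)

theorem one_le_partition (A : Matrix (Fin m) (Fin n) ℝ) (β : ℝ) (x : Fin n → ℝ) :
    1 ≤ partition A β x := by
  unfold partition
  have : 0 ≤ ∑ i, (Real.exp (β * (A *ᵥ x) i) + Real.exp (-(β * (A *ᵥ x) i))) :=
    Finset.sum_nonneg fun i _ => by positivity
  linarith

theorem partition_pos (A : Matrix (Fin m) (Fin n) ℝ) (β : ℝ) (x : Fin n → ℝ) :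
    0 < partition A β x := one_pos.trans_le (one_le_partition A β x)

theorem abs_moment_le {A : Matrix (Fin m) (Fin n) ℝ} (hA : ∀ i j, |A i j| ≤ 1) (β : ℝ)
    (x : Fin n → ℝ) (j : Fin n) : |moment A β x j| ≤ partition A β x := by
  unfold moment partition
  refine (Finset.abs_sum_le_sum_abs _ _).trans ((Finset.sum_le_sum fun i _ => ?_).trans
    (le_add_of_nonneg_left zero_le_one))
  rw [abs_mul]
  have h1 := Real.exp_pos (β * (A *ᵥ x) i)
  have h2 := Real.exp_pos (-(β * (A *ᵥ x) i))
  have h3 : |Real.exp (β * (A *ᵥ x) i) - Real.exp (-(β * (A *ᵥ x) i))| ≤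
      Real.exp (β * (A *ᵥ x) i) + Real.exp (-(β * (A *ᵥ x) i)) := by
    rw [abs_le]; constructor <;> linarith
  calc _ ≤ 1 * |Real.exp (β * (A *ᵥ x) i) - Real.exp (-(β * (A *ᵥ x) i))| := by
        gcongr; exact hA i j
    _ ≤ _ := by rw [one_mul]; exact h3

theorem sum_moment (A : Matrix (Fin m) (Fin n) ℝ) (β : ℝ) (x d : Fin n → ℝ) :
    ∑ j, d j * moment A β x j =
      ∑ i, (A *ᵥ d) i * (Real.exp (β * (A *ᵥ x) i) - Real.exp (-(β * (A *ᵥ x) i))) := by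
  simp only [moment, Finset.mul_sum, Matrix.mulVec, dotProduct, Finset.sum_mul]
  rw [Finset.sum_comm]
  exact Finset.sum_congr rfl fun i _ => Finset.sum_congr rfl fun j _ => by ring

/-- Convexity of log-sum-exp in tangent form, without derivatives. Here `R` is the softmax average
of the increments `w` of the exponents. Averaging `exp w ≥ exp R * (1 + w - R)` kills the linear
part and leaves a ratio of partition functions of at least `exp R`. -/
theorem log_partition_ge (A : Matrix (Fin m) (Fin n) ℝ) (β : ℝ) (x y : Fin n → ℝ) :
    Real.log (partition A β x) + β * ∑ j, (y j - x j) * (moment A β x j / partition A β x) ≤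
      Real.log (partition A β y) := by
  set S := partition A β x with hS
  have hSpos : 0 < S := partition_pos A β x
  set R := β * ∑ j, (y j - x j) * (moment A β x j / S) with hR
  have hRS : R * S = ∑ i, β * ((A *ᵥ y) i - (A *ᵥ x) i) *
      (Real.exp (β * (A *ᵥ x) i) - Real.exp (-(β * (A *ᵥ x) i))) := by
    have := sum_moment A β x (y - x)
    rw [Matrix.mulVec_sub] at this
    simp only [Pi.sub_apply] at this
    simp only [mul_assoc]
    rw [← Finset.mul_sum, ← this, hR, mul_assoc, Finset.sum_mul]
    congr 1
    refine Finset.sum_congr rfl fun j _ => ?_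
    field_simp
  have key : Real.exp R * S ≤ partition A β y := by
    have h1 : ∀ z w : ℝ, Real.exp R * (Real.exp z * (1 + w - R)) ≤ Real.exp (z + w) := by
      intro z w
      have : 1 + w - R ≤ Real.exp (w - R) := by linarith [Real.add_one_le_exp (w - R)]
      calc Real.exp R * (Real.exp z * (1 + w - R))
          ≤ Real.exp R * (Real.exp z * Real.exp (w - R)) := by gcongr
        _ = Real.exp (z + w) := by rw [← Real.exp_add, ← Real.exp_add]; ring_nf
    -- By `hRS` the corrections `w - R` have weighted sum zero. The constant term of the partition
    -- function takes part with exponent and increment zero.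
    have h2 : Real.exp R * S = Real.exp R * (1 - R) + ∑ i, (
        Real.exp R * (Real.exp (β * (A *ᵥ x) i) * (1 + β * ((A *ᵥ y) i - (A *ᵥ x) i) - R)) +
        Real.exp R * (Real.exp (-(β * (A *ᵥ x) i)) *
          (1 + -(β * ((A *ᵥ y) i - (A *ᵥ x) i)) - R))) := by
      have h3 : ∑ i, (
        Real.exp R * (Real.exp (β * (A *ᵥ x) i) * (1 + β * ((A *ᵥ y) i - (A *ᵥ x) i) - R)) +
        Real.exp R * (Real.exp (-(β * (A *ᵥ x) i)) *
          (1 + -(β * ((A *ᵥ y) i - (A *ᵥ x) i)) - R))) =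
          Real.exp R * (∑ i, (Real.exp (β * (A *ᵥ x) i) + Real.exp (-(β * (A *ᵥ x) i))) +
            R * S - R * ∑ i, (Real.exp (β * (A *ᵥ x) i) + Real.exp (-(β * (A *ᵥ x) i)))) := by
        rw [hRS, Finset.mul_sum _ _ R, ← Finset.sum_add_distrib, ← Finset.sum_sub_distrib,
          Finset.mul_sum]
        exact Finset.sum_congr rfl fun i _ => by ring
      rw [h3, hS, partition]
      ring
    have h4 : Real.exp R * (1 - R) ≤ 1 := by
      have := h1 0 0
      simpa using this
    rw [h2, partition]
    refine add_le_add h4 (Finset.sum_le_sum fun i _ => add_le_add ?_ ?_)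
    · refine (h1 _ _).trans (le_of_eq ?_); ring_nf
    · refine (h1 _ _).trans (le_of_eq ?_); ring_nf
  calc Real.log S + R = Real.log (Real.exp R * S) := by
        rw [Real.log_mul (Real.exp_pos R).ne' hSpos.ne', Real.log_exp, add_comm]
    _ ≤ _ := Real.log_le_log (by positivity) key

theorem soft_ge {A : Matrix (Fin m) (Fin n) ℝ} {β δ : ℝ} (hβ : 0 < β) (hδ : 0 ≤ δ)
    (g x y : Fin n → ℝ) :
    soft A β δ g x + ∑ j, (y j - x j) * slope A β δ g x j ≤ soft A β δ g y := by
  have h := mul_le_mul_of_nonneg_left (log_partition_ge A β x y) (div_nonneg hδ hβ.le)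
  have e : ∑ j, (y j - x j) * slope A β δ g x j = (g ⬝ᵥ y - g ⬝ᵥ x) +
      δ / β * (β * ∑ j, (y j - x j) * (moment A β x j / partition A β x)) := by
    have : δ / β * (β * ∑ j, (y j - x j) * (moment A β x j / partition A β x)) =
        ∑ j, δ * ((y j - x j) * (moment A β x j / partition A β x)) := by
      rw [← mul_assoc, div_mul_cancel₀ _ hβ.ne', Finset.mul_sum]
    rw [this, dotProduct, dotProduct, ← Finset.sum_sub_distrib, ← Finset.sum_add_distrib]
    exact Finset.sum_congr rfl fun j _ => by rw [slope]; ring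
  rw [mul_add] at h
  unfold soft
  rw [e]
  linarith

theorem mulVec_update (A : Matrix (Fin m) (Fin n) ℝ) (x : Fin n → ℝ) (j : Fin n) (d : ℝ)
    (i : Fin m) :
    (A *ᵥ Function.update x j (x j + d)) i = (A *ᵥ x) i + d * A i j := by
  have : Function.update x j (x j + d) = x + Pi.single j d := by
    ext k
    by_cases hk : k = j
    · subst hk; simp
    · simp [hk]
  rw [this, Matrix.mulVec_add, Pi.add_apply, Matrix.mulVec_single]
  simp [mul_comm]

/-- Each exponent changes by at most `|β * d| ≤ 1`, where `exp a ≤ 1 + a + a ^ 2`. -/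
theorem partition_update_le {A : Matrix (Fin m) (Fin n) ℝ} (hA : ∀ i j, |A i j| ≤ 1) {β d : ℝ}
    (hd : |β * d| ≤ 1) (x : Fin n → ℝ) (j : Fin n) :
    partition A β (Function.update x j (x j + d)) ≤
      partition A β x + β * d * moment A β x j + (β * d) ^ 2 * partition A β x := by
  have h1 : ∀ z a : ℝ, |a| ≤ 1 → Real.exp (z + β * d * a) ≤
      Real.exp z * (1 + β * d * a + (β * d) ^ 2) := by
    intro z a ha
    have h2 : |β * d * a| ≤ 1 := by
      rw [abs_mul]; exact mul_le_one₀ hd (abs_nonneg _) ha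
    have h3 := (abs_le.1 (Real.abs_exp_sub_one_sub_id_le h2)).2
    have h4 : (β * d * a) ^ 2 ≤ (β * d) ^ 2 := by
      rw [mul_pow]
      exact mul_le_of_le_one_right (sq_nonneg _) ((sq_le_one_iff_abs_le_one _).2 ha)
    rw [Real.exp_add]
    gcongr
    linarith
  have h5 : ∀ i, Real.exp (β * (A *ᵥ Function.update x j (x j + d)) i) +
      Real.exp (-(β * (A *ᵥ Function.update x j (x j + d)) i)) ≤
      (Real.exp (β * (A *ᵥ x) i) + Real.exp (-(β * (A *ᵥ x) i))) +
      β * d * (A i j * (Real.exp (β * (A *ᵥ x) i) - Real.exp (-(β * (A *ᵥ x) i)))) +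
      (β * d) ^ 2 * (Real.exp (β * (A *ᵥ x) i) + Real.exp (-(β * (A *ᵥ x) i))) := by
    intro i
    have a1 := h1 (β * (A *ᵥ x) i) (A i j) (hA i j)
    have a2 := h1 (-(β * (A *ᵥ x) i)) (-A i j) (by rw [abs_neg]; exact hA i j)
    rw [mulVec_update]
    rw [show β * ((A *ᵥ x) i + d * A i j) = β * (A *ᵥ x) i + β * d * A i j by ring,
      show -(β * (A *ᵥ x) i + β * d * A i j) = -(β * (A *ᵥ x) i) + β * d * -A i j by ring]
    refine (add_le_add a1 a2).trans (le_of_eq ?_)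
    ring
  have h6 := Finset.sum_le_sum fun i (_ : i ∈ Finset.univ) => h5 i
  rw [Finset.sum_add_distrib (f := fun i => _ + _), Finset.sum_add_distrib
    (f := fun i => Real.exp (β * (A *ᵥ x) i) + Real.exp (-(β * (A *ᵥ x) i))),
    ← Finset.mul_sum, ← Finset.mul_sum] at h6
  unfold moment
  have h7 := sq_nonneg (β * d)
  unfold partition
  linarith

/-- The bound on the partition function passes to its logarithm through `log t ≤ t - 1`, applied to
the ratio of the new and old values. -/
theorem soft_update_le {A : Matrix (Fin m) (Fin n) ℝ} (hA : ∀ i j, |A i j| ≤ 1) {β δ d : ℝ}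
    (hβ : 0 < β) (hδ : 0 ≤ δ) (hd : |β * d| ≤ 1) (g x : Fin n → ℝ) (j : Fin n) :
    soft A β δ g (Function.update x j (x j + d)) ≤
      soft A β δ g x + d * slope A β δ g x j + δ * β * d ^ 2 := by
  have hS := partition_pos A β x
  have h1 : Real.log (partition A β (Function.update x j (x j + d))) ≤
      Real.log (partition A β x) + (β * d * (moment A β x j / partition A β x) + (β * d) ^ 2) := by
    have h2 := Real.log_le_sub_one_of_pos
      (div_pos (partition_pos A β (Function.update x j (x j + d))) hS)
    rw [Real.log_div (partition_pos _ _ _).ne' hS.ne'] at h2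
    have h3 := div_le_div_of_nonneg_right (partition_update_le hA hd x j) hS.le
    have h4 : (partition A β x + β * d * moment A β x j + (β * d) ^ 2 * partition A β x) /
        partition A β x = 1 + β * d * (moment A β x j / partition A β x) + (β * d) ^ 2 := by
      field_simp
    rw [h4] at h3
    linarith
  have h5 := mul_le_mul_of_nonneg_left h1 (div_nonneg hδ hβ.le)
  have h6 : g ⬝ᵥ Function.update x j (x j + d) = g ⬝ᵥ x + d * g j := by
    have : Function.update x j (x j + d) = x + Pi.single j d := by
      ext k
      by_cases hk : k = j
      · subst hk; simp
      · simp [hk]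
    rw [this, dotProduct_add, dotProduct_single, mul_comm]
  have h7 : δ / β * (Real.log (partition A β x) +
      (β * d * (moment A β x j / partition A β x) + (β * d) ^ 2)) =
      δ / β * Real.log (partition A β x) + (d * (δ * (moment A β x j / partition A β x)) +
        δ * β * d ^ 2) := by
    field_simp
  unfold soft slope
  rw [h6]
  linarith

/-! ### The contraction of the exponential moment. -/

/-- One random coordinate step contracts the exponential moment of the excess. -/
theorem sum_exp_update_le {A : Matrix (Fin m) (Fin n) ℝ} (hA : ∀ i j, |A i j| ≤ 1)
    {β δ α γ θ C : ℝ} (hn : 0 < n) (hγ : 0 ≤ γ) (hβ : 0 < β) (hδ : 0 ≤ δ) (hδ1 : δ ≤ 1) (hα : 0 < α)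
    (hαβ : 2 * α * β ≤ 1) (hθ : 0 ≤ θ) (hθα : 10 * α * θ ≤ 1) {g x y σ : Fin n → ℝ}
    (hx : x ∈ cube n) (hy : y ∈ cube n) (hslope : ∀ j, |slope A β δ g x j| ≤ 4)
    (hσ : ∀ j, (σ j = -1 ∧ -γ ≤ slope A β δ g x j) ∨ (σ j = 1 ∧ slope A β δ g x j ≤ γ))
    (hC : n * (2 * γ + 4 * α * β + 100 * θ * α) ≤ C) :
    (∑ j, Real.exp (θ * (soft A β δ g (Function.update x j (x j + α * (σ j - x j))) -
      soft A β δ g y - C))) / n ≤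
      Real.exp (θ * (1 - α / n) * (soft A β δ g x - soft A β δ g y - C)) := by
  set F := soft A β δ g with hF
  set s := slope A β δ g x with hs
  have hn' : (0 : ℝ) < n := Nat.cast_pos.2 hn
  set D : Fin n → ℝ := fun j => F (Function.update x j (x j + α * (σ j - x j))) - F x with hD
  have hσx : ∀ j, |σ j - x j| ≤ 2 := fun j => by
    have := hx j
    rcases hσ j with h | h <;> rw [h.1, abs_le] <;> constructor <;> linarith [this.1, this.2]
  have hd : ∀ j, |α * (σ j - x j)| ≤ 2 * α := fun j => by
    rw [abs_mul, abs_of_pos hα]; nlinarith [hσx j]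
  have hd2 : ∀ j, (α * (σ j - x j)) ^ 2 ≤ (2 * α) ^ 2 := fun j =>
    sq_le_sq' (abs_le.1 (hd j)).1 (abs_le.1 (hd j)).2
  have hβd : ∀ j, |β * (α * (σ j - x j))| ≤ 1 := fun j => by
    rw [abs_mul, abs_of_pos hβ]; nlinarith [hd j]
  have hup : ∀ j, D j ≤ α * (σ j - x j) * s j + 4 * β * α ^ 2 := fun j => by
    have h1 := soft_update_le hA hβ hδ (hβd j) g x j
    have h2 : δ * β * (α * (σ j - x j)) ^ 2 ≤ 1 * β * (2 * α) ^ 2 := by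
      exact mul_le_mul (by gcongr) (hd2 j) (sq_nonneg _) (by positivity)
    simp only [hD]
    linarith
  -- Convexity at `x`, tested on the updated point; only the coordinate `j` of the difference
  -- survives. With `hup` this encloses `D j` two-sidedly, as the quadratic bound on the exponential
  -- needs.
  have hlow : ∀ j, α * (σ j - x j) * s j ≤ D j := fun j => by
    have h1 := soft_ge (A := A) hβ hδ g x (Function.update x j (x j + α * (σ j - x j)))
    rw [Finset.sum_eq_single j (fun b _ hb => by simp [hb]) (by simp)] at h1
    simp only [Function.update_self, add_sub_cancel_left] at h1
    simp only [hD]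
    linarith
  have hlin : ∀ j, |α * (σ j - x j) * s j| ≤ 8 * α := fun j => by
    rw [abs_mul]
    have := mul_le_mul (hd j) (hslope j) (abs_nonneg _) (by positivity)
    linarith
  have hDabs : ∀ j, |D j| ≤ 10 * α := fun j => by
    have h1 := abs_le.1 (hlin j)
    have h2 := hup j
    have h3 := hlow j
    have h4 : 4 * β * α ^ 2 ≤ 2 * α := by nlinarith
    rw [abs_le]
    constructor <;> linarith
  -- In every coordinate `σ j` is, up to `2 γ`, at least as good as `y j` for the linearized
  -- problem. A wrong sign is possible only if the slope is below `γ` in absolute value.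
  have hdir : ∀ j, α * (σ j - x j) * s j ≤ α * ((y j - x j) * s j) + 2 * α * γ := fun j => by
    have h1 : (σ j - y j) * s j ≤ 2 * γ := by
      have := hy j
      rcases hσ j with h | h <;> rw [h.1] <;> nlinarith [this.1, this.2, h.2]
    nlinarith
  have hsum : ∑ j, D j ≤ -α * (F x - F y) + n * (2 * α * γ + 4 * β * α ^ 2) := by
    calc ∑ j, D j ≤ ∑ j, (α * ((y j - x j) * s j) + (2 * α * γ + 4 * β * α ^ 2)) :=
          Finset.sum_le_sum fun j _ => by linarith [hup j, hdir j]
      _ = α * ∑ j, (y j - x j) * s j + n * (2 * α * γ + 4 * β * α ^ 2) := by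
          rw [Finset.sum_add_distrib, ← Finset.mul_sum, Finset.sum_const, Finset.card_univ,
            Fintype.card_fin, nsmul_eq_mul]
      _ ≤ _ := by
          have := soft_ge (A := A) hβ hδ g x y
          have h2 : ∑ j, (y j - x j) * s j ≤ F y - F x := by simp only [hs, hF]; linarith
          nlinarith
  -- The hypothesis `10 * α * θ ≤ 1` keeps the exponent in the range where `exp a ≤ 1 + a + a ^ 2`.
  have hexp : ∀ j, Real.exp (θ * D j) ≤ 1 + θ * D j + 100 * θ ^ 2 * α ^ 2 := fun j => by
    have h1 : |θ * D j| ≤ 10 * α * θ := by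
      rw [abs_mul, abs_of_nonneg hθ]; nlinarith [hDabs j]
    have h2 := (abs_le.1 (Real.abs_exp_sub_one_sub_id_le (h1.trans hθα))).2
    have h3 : (θ * D j) ^ 2 ≤ (10 * α * θ) ^ 2 := sq_le_sq' (abs_le.1 h1).1 (abs_le.1 h1).2
    nlinarith
  have htot : ∑ j, Real.exp (θ * D j) ≤ n * Real.exp (-(θ * (α / n) * (F x - F y - C))) := by
    calc ∑ j, Real.exp (θ * D j) ≤ ∑ j, (1 + θ * D j + 100 * θ ^ 2 * α ^ 2) :=
          Finset.sum_le_sum fun j _ => hexp j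
      _ = n + θ * ∑ j, D j + n * (100 * θ ^ 2 * α ^ 2) := by
          rw [Finset.sum_add_distrib, Finset.sum_add_distrib, ← Finset.mul_sum]; simp
      _ ≤ n + θ * (-α * (F x - F y) + n * (2 * α * γ + 4 * β * α ^ 2)) +
          n * (100 * θ ^ 2 * α ^ 2) := by gcongr
      _ = n - θ * α * (F x - F y) + θ * α * (n * (2 * γ + 4 * α * β + 100 * θ * α)) := by ring
      _ ≤ n - θ * α * (F x - F y) + θ * α * C := by gcongr
      _ = n * (-(θ * (α / n) * (F x - F y - C)) + 1) := by field_simp; ring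
      -- The bound is folded back into an exponential, so that it can be iterated.
      _ ≤ _ := by gcongr; exact Real.add_one_le_exp _
  rw [div_le_iff₀ hn']
  have e1 : ∀ j, Real.exp (θ * (F (Function.update x j (x j + α * (σ j - x j))) - F y - C)) =
      Real.exp (θ * (F x - F y - C)) * Real.exp (θ * D j) := fun j => by
    rw [← Real.exp_add]; congr 1; simp only [hD]; ring
  rw [Finset.sum_congr rfl fun j _ => e1 j, ← Finset.mul_sum]
  calc _ ≤ Real.exp (θ * (F x - F y - C)) *
        (n * Real.exp (-(θ * (α / n) * (F x - F y - C)))) := by gcongr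
    _ = _ := by
      rw [mul_left_comm, ← Real.exp_add, mul_comm]; congr 2; ring

/-! ### Approximate exponentials and the sign of the slope. -/

/-- The approximation `(1 + u / 2 ^ S) ^ (2 ^ S)` of the exponential function. -/
noncomputable def approxExp (S : ℕ) (u : ℝ) : ℝ := (1 + u / 2 ^ S) ^ 2 ^ S

/-- With `t = u / 2 ^ S` one has `exp t * (1 - t ^ 2) ≤ 1 + t ≤ exp t`. Raising this to the power `2
^ S`, Bernoulli's inequality turns the loss into the factor `1 - u ^ 2 / 2 ^ S`. -/
theorem abs_approxExp_sub_exp_le {S : ℕ} {u : ℝ} (hu : |u| ≤ 2 ^ S) :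
    |approxExp S u - Real.exp u| ≤ u ^ 2 / 2 ^ S * Real.exp u := by
  have hN : (0 : ℝ) < 2 ^ S := by positivity
  set t := u / 2 ^ S with ht
  have ht1 : |t| ≤ 1 := by rw [ht, abs_div, abs_of_pos hN]; exact (div_le_one hN).2 hu
  have ht2 := abs_le.1 ht1
  have hexp : Real.exp u = Real.exp t ^ 2 ^ S := by
    rw [← Real.exp_nat_mul]; congr 1; rw [ht]; push_cast; field_simp
  have h1 : approxExp S u ≤ Real.exp u := by
    rw [hexp, approxExp]
    exact pow_le_pow_left₀ (by linarith) (by linarith [Real.add_one_le_exp t]) _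
  have h2 : Real.exp u * (1 - u ^ 2 / 2 ^ S) ≤ approxExp S u := by
    have h3 : 1 - u ^ 2 / 2 ^ S ≤ (1 - t ^ 2) ^ 2 ^ S := by
      have := one_add_mul_le_pow (a := -t ^ 2) (by nlinarith) (2 ^ S)
      refine le_trans (le_of_eq ?_) (this.trans (le_of_eq (by ring)))
      rw [ht]; push_cast; field_simp
      ring
    have h4 : Real.exp t * (1 - t ^ 2) ≤ 1 + t := by
      have h5 : Real.exp t * (1 - t) ≤ 1 := by
        have := Real.add_one_le_exp (-t)
        calc Real.exp t * (1 - t) ≤ Real.exp t * Real.exp (-t) := by gcongr; linarith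
          _ = 1 := by rw [← Real.exp_add]; simp
      nlinarith
    calc Real.exp u * (1 - u ^ 2 / 2 ^ S) ≤ Real.exp t ^ 2 ^ S * (1 - t ^ 2) ^ 2 ^ S := by
          rw [hexp]; gcongr
      _ = (Real.exp t * (1 - t ^ 2)) ^ 2 ^ S := (mul_pow _ _ _).symm
      _ ≤ _ := pow_le_pow_left₀ (mul_nonneg (Real.exp_pos t).le (by nlinarith)) h4 _
  rw [abs_le]
  constructor <;> nlinarith [Real.exp_pos u]

/-- The approximation of the partition function. -/
noncomputable def approxPartition (S : ℕ) (A : Matrix (Fin m) (Fin n) ℝ) (β : ℝ)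
    (x : Fin n → ℝ) : ℝ :=
  1 + ∑ i, (approxExp S (β * (A *ᵥ x) i) + approxExp S (-(β * (A *ᵥ x) i)))

/-- The approximation of `moment`. -/
noncomputable def approxMoment (S : ℕ) (A : Matrix (Fin m) (Fin n) ℝ) (β : ℝ)
    (x : Fin n → ℝ) (j : Fin n) : ℝ :=
  ∑ i, A i j * (approxExp S (β * (A *ᵥ x) i) - approxExp S (-(β * (A *ᵥ x) i)))

theorem abs_mulVec_le {A : Matrix (Fin m) (Fin n) ℝ} (hA : ∀ i j, |A i j| ≤ 1) {x : Fin n → ℝ}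
    (hx : x ∈ cube n) (i : Fin m) : |(A *ᵥ x) i| ≤ n := by
  rw [Matrix.mulVec, dotProduct]
  refine (Finset.abs_sum_le_sum_abs _ _).trans ?_
  calc ∑ j, |A i j * x j| ≤ ∑ _j : Fin n, (1 : ℝ) := Finset.sum_le_sum fun j _ => by
        rw [abs_mul]; exact mul_le_one₀ (hA i j) (abs_nonneg _) (abs_le.2 (hx j))
    _ = n := by simp

/-- The sign of the computed slope is correct up to an error of `4 κ`. -/
theorem slope_sign {A : Matrix (Fin m) (Fin n) ℝ} (hA : ∀ i j, |A i j| ≤ 1) {S : ℕ} {β δ κ : ℝ}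
    (hβ : 0 < β) (hδ : 0 ≤ δ) (hδ1 : δ ≤ 1) (hβn : β * n ≤ 2 ^ S)
    (hκ : (β * n) ^ 2 / 2 ^ S ≤ κ) {g x : Fin n → ℝ}
    (hx : x ∈ cube n) (j : Fin n) (hg : |g j| ≤ 3) :
    (0 < g j * approxPartition S A β x + δ * approxMoment S A β x j →
      -(4 * κ) ≤ slope A β δ g x j) ∧
    (¬ 0 < g j * approxPartition S A β x + δ * approxMoment S A β x j →
      slope A β δ g x j ≤ 4 * κ) := by
  have hSpos := partition_pos A β x
  have hN : (0 : ℝ) < 2 ^ S := by positivity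
  have hu : ∀ i, |β * (A *ᵥ x) i| ≤ β * n := fun i => by
    rw [abs_mul, abs_of_pos hβ]; gcongr; exact abs_mulVec_le hA hx i
  have key : ∀ u : ℝ, |u| ≤ β * n → |approxExp S u - Real.exp u| ≤ κ * Real.exp u := fun u h => by
    refine (abs_approxExp_sub_exp_le (h.trans hβn)).trans ?_
    have : u ^ 2 ≤ (β * n) ^ 2 := sq_le_sq' (abs_le.1 h).1 (abs_le.1 h).2
    have h2 : u ^ 2 / 2 ^ S ≤ κ := le_trans (by gcongr) hκ
    gcongr
  have hκ0 : 0 ≤ κ := le_trans (by positivity) hκ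
  have k1 : ∀ i, |approxExp S (β * (A *ᵥ x) i) - Real.exp (β * (A *ᵥ x) i)| ≤
    κ * Real.exp (β * (A *ᵥ x) i) := fun i => key _ (hu i)
  have k2 : ∀ i, |approxExp S (-(β * (A *ᵥ x) i)) - Real.exp (-(β * (A *ᵥ x) i))| ≤
    κ * Real.exp (-(β * (A *ᵥ x) i)) := fun i => key _ (by rw [abs_neg]; exact hu i)
  have e1 : |approxPartition S A β x - partition A β x| ≤ κ * partition A β x := by
    rw [approxPartition, partition, add_sub_add_left_eq_sub, ← Finset.sum_sub_distrib, mul_add,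
      Finset.mul_sum]
    refine (Finset.abs_sum_le_sum_abs _ _).trans ((Finset.sum_le_sum fun i _ => ?_).trans
      (le_add_of_nonneg_left (by linarith)))
    rw [add_sub_add_comm, mul_add]
    exact (abs_add_le _ _).trans (add_le_add (k1 i) (k2 i))
  have e2 : |approxMoment S A β x j - moment A β x j| ≤ κ * partition A β x := by
    rw [approxMoment, moment, partition, ← Finset.sum_sub_distrib, mul_add, Finset.mul_sum]
    refine (Finset.abs_sum_le_sum_abs _ _).trans ((Finset.sum_le_sum fun i _ => ?_).trans
      (le_add_of_nonneg_left (by linarith)))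
    rw [← mul_sub, abs_mul, sub_sub_sub_comm, mul_add]
    refine (mul_le_of_le_one_left (abs_nonneg _) (hA i j)).trans ((abs_sub _ _).trans ?_)
    exact add_le_add (k1 i) (k2 i)
  -- Only the sign matters, so the slope is multiplied by the positive partition function. The
  -- resulting errors are `3 κ` from `|g j| ≤ 3` and `κ` from `δ ≤ 1`, relative to the partition
  -- function.
  have e3 : slope A β δ g x j * partition A β x =
      g j * partition A β x + δ * moment A β x j := by
    rw [slope]; field_simp
  have e4 : |g j * (approxPartition S A β x - partition A β x)| ≤ 3 * (κ * partition A β x) := by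
    rw [abs_mul]; exact mul_le_mul hg e1 (abs_nonneg _) (by norm_num)
  have e5 : |δ * (approxMoment S A β x j - moment A β x j)| ≤ 1 * (κ * partition A β x) := by
    rw [abs_mul, abs_of_nonneg hδ]; exact mul_le_mul hδ1 e2 (abs_nonneg _) (by norm_num)
  have e6 := abs_le.1 e4
  have e7 := abs_le.1 e5
  constructor
  · intro h
    refine le_of_mul_le_mul_right ?_ hSpos
    rw [e3]
    linarith [e6.2, e7.2]
  · intro h
    refine le_of_mul_le_mul_right ?_ hSpos
    rw [e3]
    linarith [e6.1, e7.1]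

theorem abs_slope_le {A : Matrix (Fin m) (Fin n) ℝ} (hA : ∀ i j, |A i j| ≤ 1) {β δ : ℝ}
    (hδ : 0 ≤ δ) (hδ1 : δ ≤ 1) {g : Fin n → ℝ} (x : Fin n → ℝ) (j : Fin n)
    (hg : |g j| ≤ 3) : |slope A β δ g x j| ≤ 4 := by
  have hS := partition_pos A β x
  have h1 : |moment A β x j / partition A β x| ≤ 1 := by
    rw [abs_div, abs_of_pos hS]; exact (div_le_one hS).2 (abs_moment_le hA β x j)
  have h2 : |δ * (moment A β x j / partition A β x)| ≤ 1 := by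
    rw [abs_mul, abs_of_nonneg hδ]; exact mul_le_one₀ hδ1 (abs_nonneg _) h1
  rw [slope]
  exact (abs_add_le _ _).trans (by linarith)

/-! ### Comparison of the smoothed objective with the sup norm. -/

/-- The largest `|(A *ᵥ x) i|` already contributes its exponential to the partition function. The
constant term `1` makes the logarithm nonnegative even if there are no rows. -/
theorem norm_le_soft {A : Matrix (Fin m) (Fin n) ℝ} {β δ : ℝ} (hβ : 0 < β) (hδ : 0 ≤ δ)
    (g x : Fin n → ℝ) : g ⬝ᵥ x + δ * ‖A *ᵥ x‖ ≤ soft A β δ g x := by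
  have h1 : β * ‖A *ᵥ x‖ ≤ Real.log (partition A β x) := by
    rw [mul_comm, ← le_div_iff₀ hβ]
    have h0 : 0 ≤ Real.log (partition A β x) := Real.log_nonneg (one_le_partition A β x)
    refine (pi_norm_le_iff_of_nonneg (by positivity)).2 fun i => ?_
    rw [le_div_iff₀ hβ, Real.le_log_iff_exp_le (partition_pos A β x), Real.norm_eq_abs]
    have h2 : Real.exp (β * (A *ᵥ x) i) + Real.exp (-(β * (A *ᵥ x) i)) ≤ partition A β x := by
      rw [partition]
      have := Finset.single_le_sum (f := fun i => Real.exp (β * (A *ᵥ x) i) +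
        Real.exp (-(β * (A *ᵥ x) i))) (fun i _ => by positivity) (Finset.mem_univ i)
      linarith
    have h3 := Real.exp_pos (β * (A *ᵥ x) i)
    have h4 := Real.exp_pos (-(β * (A *ᵥ x) i))
    rcases abs_cases ((A *ᵥ x) i) with h | h
    · rw [h.1, mul_comm]; linarith
    · rw [h.1, neg_mul, mul_comm]; linarith
  rw [soft]
  have h2 := mul_le_mul_of_nonneg_left h1 (div_nonneg hδ hβ.le)
  have h3 : δ / β * (β * ‖A *ᵥ x‖) = δ * ‖A *ᵥ x‖ := by field_simp
  linarith

theorem soft_le_norm {A : Matrix (Fin m) (Fin n) ℝ} {β δ : ℝ} (hβ : 0 < β) (hδ : 0 ≤ δ)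
    (g x : Fin n → ℝ) :
    soft A β δ g x ≤ g ⬝ᵥ x + δ * ‖A *ᵥ x‖ + δ / β * Real.log (1 + 2 * m) := by
  have h1 : partition A β x ≤ (1 + 2 * m) * Real.exp (β * ‖A *ᵥ x‖) := by
    have h2 : ∀ i, Real.exp (β * (A *ᵥ x) i) + Real.exp (-(β * (A *ᵥ x) i)) ≤
        2 * Real.exp (β * ‖A *ᵥ x‖) := fun i => by
      have h3 : |(A *ᵥ x) i| ≤ ‖A *ᵥ x‖ := norm_le_pi_norm (A *ᵥ x) i
      have h4 := abs_le.1 h3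
      have h5 : Real.exp (β * (A *ᵥ x) i) ≤ Real.exp (β * ‖A *ᵥ x‖) :=
        Real.exp_le_exp.2 (by nlinarith)
      have h6 : Real.exp (-(β * (A *ᵥ x) i)) ≤ Real.exp (β * ‖A *ᵥ x‖) :=
        Real.exp_le_exp.2 (by nlinarith)
      linarith
    have h3 := Finset.sum_le_sum fun i (_ : i ∈ Finset.univ) => h2 i
    rw [Finset.sum_const, Finset.card_univ, Fintype.card_fin, nsmul_eq_mul] at h3
    have h4 : 1 ≤ Real.exp (β * ‖A *ᵥ x‖) := Real.one_le_exp (by positivity)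
    rw [partition]
    linarith
  have h2 := Real.log_le_log (partition_pos A β x) h1
  rw [Real.log_mul (by positivity) (Real.exp_pos _).ne', Real.log_exp] at h2
  have h3 := mul_le_mul_of_nonneg_left h2 (div_nonneg hδ hβ.le)
  have h4 : δ / β * (Real.log (1 + 2 * m) + β * ‖A *ᵥ x‖) =
      δ * ‖A *ᵥ x‖ + δ / β * Real.log (1 + 2 * m) := by
    field_simp; ring
  rw [soft]
  linarith

end PenalizedOptimization

/-! ### Subroutines: exponentials, partial derivatives, image updates. -/

namespace PenalizedOptimization

open RealRAM RealRAM.Op SparseMatrix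

variable {m n : ℕ}

/-- Computes `(1 ± c z) ^ (2 ^ S)` for `z` in real variable 15. -/
def expCode : Program :=
  .seq (block [realMul 16 7 15, realSub 17 2 16, realAdd 16 2 16, natConst 16 0])
    (.loop (.natLT 16 4) (block [realMul 16 16 16, realMul 17 17 17, natAdd 16 16 2]))

/-- Squaring `S` times yields the exponent `2 ^ S`. Natural variable 2 permanently holds `1` and
serves as the loop increment. -/
theorem expCode_ensures {B S : ℕ} {s : State} (hw : s.WordsLE B) (h2 : s.nat 2 = 1)
    (h4 : s.nat 4 = S) (hr : s.real 2 = 1) :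
    Ensures B expCode s (8 * S + 11) fun s' => Frame 16 16 s s' ∧ s'.realArr = s.realArr ∧
      s'.real 16 = (1 + s.real 7 * s.real 15) ^ 2 ^ S ∧
      s'.real 17 = (1 - s.real 7 * s.real 15) ^ 2 ^ S := by
  have hS : S ≤ B := h4 ▸ hw.1 4
  refine (Ensures.seq (T₁ := 9) (T₂ := S * (7 + 1) + 1) (R := fun s' => Frame 16 16 s s' ∧
    s'.realArr = s.realArr ∧ s'.nat 16 = 0 ∧ s'.real 16 = 1 + s.real 7 * s.real 15 ∧
    s'.real 17 = 1 - s.real 7 * s.real 15) hw (Ensures.block hw ?_ ?_) ?_).le (by omega)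
  · simp
  · simp [hr]
  rintro s₁ hw₁ ⟨hf, ha, h16, hr16, hr17⟩
  refine (Ensures.loop (fun k s' => Frame 16 16 s s' ∧ s'.realArr = s.realArr ∧ s'.nat 16 = k ∧
    s'.real 16 = (1 + s.real 7 * s.real 15) ^ 2 ^ k ∧
    s'.real 17 = (1 - s.real 7 * s.real 15) ^ 2 ^ k) S hw₁ ?_ ?_ ?_).mono le_rfl
      fun s' _ h => ⟨h.1, h.2.1, h.2.2.2⟩
  · simp [*]
  · rintro k hk s' hw' ⟨hf', ha', h16', hr16', hr17'⟩
    have e2 := hf'.nat 2 (by norm_num)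
    have e4 := hf'.nat 4 (by norm_num)
    refine ⟨by simp [Test.Holds, *], Ensures.block hw' ?_ ?_⟩
    · simp [*]; omega
    · simp [*]
      constructor <;> ring
  · rintro s' ⟨hf', ha', h16', -⟩
    have e4 := hf'.nat 4 (by norm_num)
    simp [Test.Holds, *]

/-- The constants in the memory during the main loop. -/
structure Globals (A : Matrix (Fin m) (Fin n) ℝ) (S T : ℕ) (β α δ : ℝ) (s : State) : Prop where
  dim : s.nat 0 = n
  natOne : s.nat 2 = 1
  squarings : s.nat 4 = S
  iterations : s.nat 5 = T
  penalty : s.real 1 = δ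
  realOne : s.real 2 = 1
  realZero : s.real 3 = 0
  stepSize : s.real 5 = α
  stepSize' : s.real 6 = 1 - α
  scale : s.real 7 = β / 2 ^ S
  starts : s.natArr 0 = columnStart A
  rows : s.natArr 1 = rowIndex A

theorem Globals.of_frame {A : Matrix (Fin m) (Fin n) ℝ} {S T L R : ℕ} {β α δ : ℝ} {s s' : State}
    (h : Globals A S T β α δ s) (hf : Frame L R s s') (hL : 8 ≤ L := by norm_num)
    (hR : 8 ≤ R := by norm_num) : Globals A S T β α δ s' where
  dim := (hf.nat _ (by omega)).trans h.dim
  natOne := (hf.nat _ (by omega)).trans h.natOne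
  squarings := (hf.nat _ (by omega)).trans h.squarings
  iterations := (hf.nat _ (by omega)).trans h.iterations
  penalty := (hf.real _ (by omega)).trans h.penalty
  realOne := (hf.real _ (by omega)).trans h.realOne
  realZero := (hf.real _ (by omega)).trans h.realZero
  stepSize := (hf.real _ (by omega)).trans h.stepSize
  stepSize' := (hf.real _ (by omega)).trans h.stepSize'
  scale := (hf.real _ (by omega)).trans h.scale
  starts := by rw [hf.natArr, h.starts]
  rows := by rw [hf.natArr, h.rows]

theorem Globals.expCode_ensures {A : Matrix (Fin m) (Fin n) ℝ} {S T : ℕ} {β α δ : ℝ} {s : State}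
    (h : Globals A S T β α δ s) {B : ℕ} (hw : s.WordsLE B) :
    Ensures B expCode s (8 * S + 11) fun s' => Frame 16 16 s s' ∧ s'.realArr = s.realArr ∧
      s'.real 16 = approxExp S (β * s.real 15) ∧ s'.real 17 = approxExp S (-(β * s.real 15)) := by
  refine (PenalizedOptimization.expCode_ensures hw h.natOne h.squarings h.realOne).mono le_rfl ?_
  rintro s' - ⟨h1, h2, h3, h4⟩
  refine ⟨h1, h2, h3.trans ?_, h4.trans ?_⟩
  · rw [h.scale, approxExp]; ring_nf
  · rw [h.scale, approxExp]; ring_nf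

/-- The body of the loop that computes a partial derivative. -/
def momentBody : Program :=
  .seq (block [natLoad 13 1 12, realLoad 14 3 12, realLoad 15 5 13])
    (.seq expCode (block [realSub 16 16 17, realMul 16 14 16, realAdd 13 13 16, natAdd 12 12 2]))

/-- Adds to real variable 13 the moment of a column. -/
def momentCode : Program := .loop (.natLT 12 11) momentBody

theorem momentCode_ensures {A : Matrix (Fin m) (Fin n) ℝ} {S T : ℕ} {β α δ : ℝ} {s : State}
    (h : Globals A S T β α δ s) {B : ℕ} (hw : s.WordsLE B) (j : Fin n)
    (hv : s.realArr 3 = value A) (hlo : s.nat 12 = columnStart A j)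
    (hhi : s.nat 11 = columnStart A (j + 1)) (h0 : s.real 13 = 0) :
    Ensures B momentCode s ((column A j).length * (8 * S + 30) + 1) fun s' =>
      Frame 12 13 s s' ∧ s'.realArr = s.realArr ∧ s'.real 13 = ∑ i, A i j *
        (approxExp S (β * s.realArr 5 i) - approxExp S (-(β * s.realArr 5 i))) := by
  have hB : columnStart A (j + 1) ≤ B := hhi ▸ hw.1 11
  rw [columnStart_succ] at hhi hB
  refine (Ensures.loop (T := 8 * S + 29) (fun q s' => Frame 12 13 s s' ∧ s'.realArr = s.realArr ∧
    s'.nat 12 = columnStart A j + q ∧ s'.real 13 = ∑ p ∈ Finset.range q,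
      value A (columnStart A j + p) *
        (approxExp S (β * s.realArr 5 (rowIndex A (columnStart A j + p))) -
          approxExp S (-(β * s.realArr 5 (rowIndex A (columnStart A j + p))))))
    (column A j).length hw ?_ ?_ ?_).mono (by ring_nf; rfl) ?_
  · simp [*]
  · rintro q hq s₁ hw₁ ⟨hf₁, ha₁, hp₁, hr₁⟩
    have g₁ := h.of_frame hf₁
    have e11 := hf₁.nat 11 (by norm_num)
    refine ⟨by simp [Test.Holds, *], ?_⟩
    refine (Ensures.seq (T₁ := 7) (T₂ := 1 + (8 * S + 11) + 9) (R := fun s' => Frame 13 14 s₁ s' ∧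
      s'.realArr = s₁.realArr ∧ s'.real 14 = value A (columnStart A j + q) ∧
      s'.real 15 = s₁.realArr 5 (rowIndex A (columnStart A j + q))) hw₁
      (Ensures.block hw₁ ?_ ?_) ?_).le (by omega)
    · simp
    · simp [*, g₁.rows]
    rintro s₂ hw₂ ⟨hf₂, ha₂, h14, h15⟩
    have g₂ := g₁.of_frame hf₂
    refine Ensures.seq hw₂ (g₂.expCode_ensures hw₂) ?_
    rintro s₃ hw₃ ⟨hf₃, ha₃, h16, h17⟩
    have g₃ := g₂.of_frame hf₃
    have e12 := (hf₃.nat 12 (by norm_num)).trans (hf₂.nat 12 (by norm_num))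
    have e13 := (hf₃.real 13 (by norm_num)).trans (hf₂.real 13 (by norm_num))
    have e14 := hf₃.real 14 (by norm_num)
    have f₃ : Frame 12 13 s s₃ := hf₁.trans (hf₂.of_le.trans hf₃.of_le)
    refine Ensures.block hw₃ ?_ ?_
    · simp [g₃.natOne, *]; omega
    · simp [g₃.natOne, *, Finset.sum_range_succ, add_assoc]
  · rintro s₁ ⟨hf₁, -, hp₁, -⟩
    have e11 := hf₁.nat 11 (by norm_num)
    simp [Test.Holds, *]
  · rintro s' - ⟨hf, ha, -, hr⟩
    refine ⟨hf, ha, hr.trans ?_⟩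
    exact sum_column A j fun i => approxExp S (β * s.realArr 5 i) -
      approxExp S (-(β * s.realArr 5 i))

/-- The body of the loop that updates the image of the current point. -/
def imageBody : Program :=
  .seq (block [natLoad 13 1 12, realLoad 14 3 12, realLoad 15 5 13])
    (.seq expCode (.seq (block [realSub 12 12 16, realSub 12 12 17, realMul 14 14 11,
      realAdd 15 15 14, realStore 5 13 15])
      (.seq expCode (block [realAdd 12 12 16, realAdd 12 12 17, natAdd 12 12 2]))))

/-- Adds a multiple of a column to the image of the current point. -/
def imageCode : Program := .loop (.natLT 12 11) imageBody

theorem sum_update_eq (f : ℝ → ℝ) (z : ℕ → ℝ) {r : ℕ} (hr : r < m) (y : ℝ) :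
    ∑ i : Fin m, f (Function.update z r y i) = ∑ i : Fin m, f (z i) - f (z r) + f y := by
  have h1 : ∀ w : ℕ → ℝ, ∑ i : Fin m, f (w i) =
      f (w r) + ∑ i ∈ Finset.univ.erase (⟨r, hr⟩ : Fin m), f (w i) := fun w =>
    (Finset.add_sum_erase _ (fun i : Fin m => f (w i)) (Finset.mem_univ ⟨r, hr⟩)).symm
  have h2 : ∑ i ∈ Finset.univ.erase (⟨r, hr⟩ : Fin m), f (Function.update z r y i) =
      ∑ i ∈ Finset.univ.erase (⟨r, hr⟩ : Fin m), f (z i) := Finset.sum_congr rfl fun i hi => by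
    rw [Function.update_of_ne]
    exact fun e => (Finset.mem_erase.1 hi).1 (Fin.ext e)
  rw [h1, h1 z, h2, Function.update_self]
  ring

/-- The weight in real variable 12 stays exact after every single entry: the two old exponentials
are subtracted, the entry is changed, the two new ones are added. Hence the cost depends on the
column length and not on `m`. -/
theorem imageCode_ensures {A : Matrix (Fin m) (Fin n) ℝ} {S T : ℕ} {β α δ : ℝ} {s : State}
    (h : Globals A S T β α δ s) {B : ℕ} (hw : s.WordsLE B) (j : Fin n)
    (hv : s.realArr 3 = value A) (hlo : s.nat 12 = columnStart A j)
    (hhi : s.nat 11 = columnStart A (j + 1))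
    (hW : s.real 12 = 1 + ∑ i : Fin m, (approxExp S (β * s.realArr 5 i) +
      approxExp S (-(β * s.realArr 5 i)))) :
    Ensures B imageCode s ((column A j).length * (16 * S + 60) + 1) fun s' =>
      Frame 12 12 s s' ∧ (∀ a, a ≠ 5 → s'.realArr a = s.realArr a) ∧
      (∀ i : Fin m, s'.realArr 5 i = s.realArr 5 i + s.real 11 * A i j) ∧
      s'.real 12 = 1 + ∑ i : Fin m, (approxExp S (β * s'.realArr 5 i) +
        approxExp S (-(β * s'.realArr 5 i))) := by
  have hB : columnStart A (j + 1) ≤ B := hhi ▸ hw.1 11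
  rw [columnStart_succ] at hhi hB
  refine (Ensures.loop (T := 16 * S + 59) (fun q s' => Frame 12 12 s s' ∧
    (∀ a, a ≠ 5 → s'.realArr a = s.realArr a) ∧ s'.nat 12 = columnStart A j + q ∧
    (∀ i : ℕ, s'.realArr 5 i = s.realArr 5 i + s.real 11 * ∑ p ∈ Finset.range q,
      value A (columnStart A j + p) * if rowIndex A (columnStart A j + p) = i then 1 else 0) ∧
    s'.real 12 = 1 + ∑ i : Fin m, (approxExp S (β * s'.realArr 5 i) +
        approxExp S (-(β * s'.realArr 5 i))))
    (column A j).length hw ?_ ?_ ?_).mono (by ring_nf; rfl) ?_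
  · simp [*]
  · rintro q hq s₁ hw₁ ⟨hf₁, ha₁, hp₁, hz₁, hr₁⟩
    have g₁ := h.of_frame hf₁
    have e11 := hf₁.nat 11 (by norm_num)
    have a3 := (ha₁ 3 (by norm_num)).trans hv
    refine ⟨by simp [Test.Holds, *], ?_⟩
    refine (Ensures.seq (T₁ := 7) (T₂ := 1 + (8 * S + 11) + (1 + 11 + (1 + (8 * S + 11) + 7)))
      (R := fun s' => Frame 13 14 s₁ s' ∧ s'.nat 13 = rowIndex A (columnStart A j + q) ∧
      s'.realArr = s₁.realArr ∧ s'.real 14 = value A (columnStart A j + q) ∧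
      s'.real 15 = s₁.realArr 5 (rowIndex A (columnStart A j + q))) hw₁
      (Ensures.block hw₁ ?_ ?_) ?_).le (by omega)
    · simp
    · simp [*, g₁.rows]
    rintro s₂ hw₂ ⟨hf₂, n13, ha₂, h14, h15⟩
    have g₂ := g₁.of_frame hf₂
    refine Ensures.seq hw₂ (g₂.expCode_ensures hw₂) ?_
    rintro s₃ hw₃ ⟨hf₃, ha₃, h16, h17⟩
    have g₃ := g₂.of_frame hf₃
    have f13 : Frame 13 12 s₁ s₃ := hf₂.of_le.trans hf₃.of_le
    have f₃ : Frame 12 12 s s₃ := hf₁.trans f13.of_le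
    have e12 := (hf₃.nat 12 (by norm_num)).trans (hf₂.nat 12 (by norm_num))
    have r12 := (hf₃.real 12 (by norm_num)).trans (hf₂.real 12 (by norm_num))
    have e13 := hf₃.nat 13 (by norm_num)
    have e14 := hf₃.real 14 (by norm_num)
    have e15 := hf₃.real 15 (by norm_num)
    have r11 := f₃.real 11 (by norm_num)
    refine Ensures.seq hw₃ (R := fun s' => Frame 13 12 s₃ s' ∧
      (∀ a, a ≠ 5 → s'.realArr a = s₁.realArr a) ∧
      s'.real 15 = s₁.realArr 5 (rowIndex A (columnStart A j + q)) +
        value A (columnStart A j + q) * s.real 11 ∧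
      s'.realArr 5 = Function.update (s₁.realArr 5) (rowIndex A (columnStart A j + q))
        (s'.real 15) ∧
      s'.real 12 = s₁.real 12 - approxExp S (β * s₁.realArr 5 (rowIndex A (columnStart A j + q))) -
        approxExp S (-(β * s₁.realArr 5 (rowIndex A (columnStart A j + q)))))
      (Ensures.block hw₃ ?_ ?_) ?_
    · simp
    · simp only [h15] at h16 h17
      simp [n13, e13, e14, h14, e15, h15, r11, r12, h16, h17, ha₃, ha₂]
      intro a ha ha'
      exact absurd ha' ha
    rintro s₄ hw₄ ⟨hf₄, ha₄, h15', ha5, h12⟩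
    have g₄ := g₃.of_frame hf₄
    refine Ensures.seq hw₄ (g₄.expCode_ensures hw₄) ?_
    rintro s₅ hw₅ ⟨hf₅, ha₅, h16', h17'⟩
    have g₅ := g₄.of_frame hf₅
    have e12' := (hf₅.nat 12 (by norm_num)).trans (hf₄.nat 12 (by norm_num))
    have r12' := hf₅.real 12 (by norm_num)
    have f₅ : Frame 12 12 s s₅ := f₃.trans (hf₄.of_le.trans hf₅.of_le)
    have hrow := rowIndex_lt A j q hq
    refine Ensures.block hw₅ ?_ ?_
    · simp [g₅.natOne, e12', e12, hp₁]; omega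
    · simp only [execs, Op.exec]
      refine ⟨by simpa using f₅, fun a ha => ?_, ?_, fun i => ?_, ?_⟩
      · simp [ha₅, ha₄ a ha, ha₁ a ha]
      · simp [g₅.natOne, e12', e12, hp₁, add_assoc]
      · simp only [State.realArr_setNat, State.realArr_setReal]
        rw [ha₅, ha5, h15', Finset.sum_range_succ, Function.update_apply]
        by_cases hi : i = rowIndex A (columnStart A j + q)
        · rw [if_pos hi, if_pos hi.symm, hz₁, hi]; ring
        · rw [if_neg hi, if_neg (Ne.symm hi), hz₁]; ring
      · simp only [State.realArr_setNat, State.realArr_setReal]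
        rw [ha₅, ha5, sum_update_eq (fun u => approxExp S (β * u) + approxExp S (-(β * u))) _ hrow]
        simp [h16', h17', r12', h12, hr₁]
        ring
  · rintro s₁ ⟨hf₁, -, hp₁, -⟩
    have e11 := hf₁.nat 11 (by norm_num)
    simp [Test.Holds, *]
  · rintro s' - ⟨hf, ha, -, hz, hr⟩
    refine ⟨hf, ha, fun i => ?_, hr⟩
    -- The invariant collects the stored entries with row `i` by an indicator; summing over the
    -- column leaves `A i j`.
    rw [hz, sum_column A j fun p => if p = i then 1 else 0]
    congr 2
    rw [Finset.sum_eq_single i]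
    · simp
    · intro b _ hb
      simp [Fin.val_ne_of_ne hb]
    · simp

/-! ### Uniform sampling of a coordinate. -/

/-- Stores a uniformly random natural number below `n` in variable 9. -/
def sampleCode : Program :=
  .seq (block [natConst 14 0, natConst 9 0])
    (.loop (.natLT 14 0)
      (.seq (block [natAdd 17 14 2, realOfNat 14 17, realDiv 14 2 14])
        (.seq (.coin 15 14)
          (.seq (.ite (.natEQ 15 2) (block [natMul 9 14 2]) (block [.skip]))
            (.op (natAdd 14 14 2))))))

/-- Reservoir sampling: in round `k` the candidate is replaced by `k` with probability `1 / (k +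
1)`. Multiplication by variable 2, which holds `1`, acts as a copy instruction. -/
theorem sampleCode_halts {B : ℕ} {E : State → Prop} {s : State} {K : List Program} {T : ℕ}
    {φ : ℕ → ℝ} (hn : 0 < n) (hw : s.WordsLE B) (h0 : s.nat 0 = n) (h2 : s.nat 2 = 1)
    (hr2 : s.real 2 = 1) (hB : n + 1 ≤ B)
    (hK : ∀ s' j, s'.WordsLE B → Frame 9 13 s s' → s'.realArr = s.realArr → j < n →
      s'.nat 9 = j → Halts B E (K, s') T (φ j)) :
    Halts B E (sampleCode :: K, s) (20 * n + 10 + T) ((∑ j ∈ Finset.range n, φ j) / n) := by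
  have hn' : (0 : ℝ) < n := Nat.cast_pos.2 hn
  -- Before round `k` the current candidate `j` stands for `k` of the `n` equally likely outcomes.
  -- The initial candidate `0` has weight zero, which explains the alternative `j = 0`.
  have main : ∀ r k j s₁, k + r = n → s₁.WordsLE B → Frame 9 13 s s₁ → s₁.realArr = s.realArr →
      s₁.nat 14 = k → s₁.nat 9 = j → (j < k ∨ j = 0) →
      Halts B E (.loop (.natLT 14 0)
      (.seq (block [natAdd 17 14 2, realOfNat 14 17, realDiv 14 2 14])
        (.seq (.coin 15 14)
          (.seq (.ite (.natEQ 15 2) (block [natMul 9 14 2]) (block [.skip]))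
            (.op (natAdd 14 14 2))))) :: K, s₁) (20 * r + 1 + T)
        ((k * φ j + ∑ i ∈ Finset.Ico k n, φ i) / n) := by
    intro r
    induction r with
    | zero =>
      intro k j s₁ hk hw₁ hf ha h14 h9 hj
      obtain rfl : k = n := by omega
      have e0 := hf.nat 0 (by norm_num)
      rw [show 20 * 0 + 1 + T = T + 1 by ring]
      refine Halts.of_step_eq_pure (by rw [step, if_neg (by simp [Test.Holds, *])]) hw₁
        ((hK s₁ j hw₁ hf ha (by omega) h9).mono le_rfl ?_)
      rw [Finset.Ico_self, Finset.sum_empty, add_zero, mul_div_assoc, mul_div_cancel₀]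
      exact hn'.ne'
    | succ r ih =>
      intro k j s₁ hk hw₁ hf ha h14 h9 hj
      have e0 := hf.nat 0 (by norm_num)
      have e2 := hf.nat 2 (by norm_num)
      have er2 := hf.real 2 (by norm_num)
      have hk1 : (0 : ℝ) < (k : ℝ) + 1 := by positivity
      refine Halts.mono (T := ((1 + 7 + (((((1 + 5) + 1 + (20 * r + 1 + T)) + 1) + 1) + 1)) + 1))
        (x := ((k * φ j + ∑ i ∈ Finset.Ico k n, φ i) / n)) ?_ (by omega) le_rfl
      refine Halts.of_step_eq_pure (by rw [step, if_pos (by simp [Test.Holds, *]; omega)]) hw₁ ?_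
      rw [show 1 + 7 + (((((1 + 5) + 1 + (20 * r + 1 + T)) + 1) + 1) + 1) =
        7 + (((((1 + 5) + 1 + (20 * r + 1 + T)) + 1) + 1) + 1) + 1 by ring]
      refine Halts.of_step_eq_pure (by rw [step]) hw₁ ?_
      refine Ensures.block (Q := fun s' => Frame 9 13 s s' ∧ s'.realArr = s.realArr ∧
        s'.nat 14 = k ∧ s'.nat 9 = j ∧ s'.real 14 = 1 / ((k : ℝ) + 1)) hw₁ ?_ ?_ E _ _ _ ?_
      · simp [*]; omega
      · simp [*]
      rintro s₂ hw₂ ⟨hf₂, ha₂, h14₂, h9₂, hr₂⟩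
      refine Halts.of_step_eq_pure (by rw [step]) hw₂ ?_
      have rest : ∀ b : ℕ, b ≤ 1 → Halts B E (.seq (.ite (.natEQ 15 2) (block [natMul 9 14 2])
          (block [.skip])) (.op (natAdd 14 14 2)) :: .loop (.natLT 14 0)
          (.seq (block [natAdd 17 14 2, realOfNat 14 17, realDiv 14 2 14])
          (.seq (.coin 15 14)
          (.seq (.ite (.natEQ 15 2) (block [natMul 9 14 2]) (block [.skip]))
            (.op (natAdd 14 14 2))))) :: K, s₂.setNat 15 b) (((1 + 5) + 1 + (20 * r + 1 + T)) + 1)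
          ((((k + 1 : ℕ) : ℝ) * φ (if b = 1 then k else j) +
            ∑ i ∈ Finset.Ico (k + 1) n, φ i) / n) := by
        intro b hb
        have hw₃ : (s₂.setNat 15 b).WordsLE B :=
          hw₂.exec (o := natConst 15 b) (by simp only [Op.Fits]; omega)
        refine Halts.of_step_eq_pure (by rw [step]) hw₃ ?_
        have e2₂ := hf₂.nat 2 (by norm_num)
        rw [add_assoc]
        refine Ensures.ite (T := 5) (Q := fun s' => Frame 9 13 s s' ∧ s'.realArr = s.realArr ∧
          s'.nat 14 = k ∧ s'.nat 9 = if b = 1 then k else j) hw₃ (fun hb1 => ?_) (fun hb1 => ?_)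
          E _ _ _ ?_
        · have hb1 : b = 1 := by simpa [Test.Holds, *] using hb1
          refine (Ensures.block hw₃ ?_ ?_).le (by simp)
          · simp [*]; omega
          · simp [*]
        · have hb1 : b ≠ 1 := by simpa [Test.Holds, *] using hb1
          refine (Ensures.block hw₃ ?_ ?_).le (by simp)
          · simp
          · simp [*]
        rintro s₄ hw₄ ⟨hf₄, ha₄, h14₄, h9₄⟩
        have e2₄ := hf₄.nat 2 (by norm_num)
        have fit : Op.Fits B (natAdd 14 14 2) s₄ := by
          rw [Op.Fits, h14₄, e2₄, h2]; omega
        rw [add_comm 1]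
        refine Halts.of_step_eq_pure (by rw [step]) hw₄
          (ih (k + 1) (if b = 1 then k else j) _ (by omega) (hw₄.exec fit) ?_ ?_ ?_ ?_ ?_)
        · simpa using hf₄
        · simpa using ha₄
        · simp [*]
        · simp [*]
        · split_ifs
          · omega
          · omega
      have hcoin := Halts.coin (a := 14) hw₂ (by rw [hr₂]; positivity)
        (by rw [hr₂]; exact (div_le_one hk1).2 (by linarith [(Nat.cast_nonneg k : (0 : ℝ) ≤ k)]))
        (rest 1 le_rfl) (rest 0 (by omega))
      refine hcoin.mono le_rfl (le_of_eq ?_)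
      rw [hr₂, Finset.sum_eq_sum_Ico_succ_bot (by omega : k < n)]
      simp only [if_true, zero_ne_one, if_false]
      push_cast
      field_simp
      ring
  refine Halts.mono (T := 5 + (20 * n + 1 + T) + 1)
    (x := ((0 : ℕ) * φ 0 + ∑ i ∈ Finset.Ico 0 n, φ i) / n) ?_ (by omega) (le_of_eq (by simp))
  unfold sampleCode
  refine Halts.of_step_eq_pure (by rw [step]) hw ?_
  refine Ensures.block (Q := fun s' => Frame 9 13 s s' ∧ s'.realArr = s.realArr ∧
    s'.nat 14 = 0 ∧ s'.nat 9 = 0) hw ?_ ?_ E _ _ _ ?_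
  · simp
  · simp
  rintro s₁ hw₁ ⟨hf, ha, h14, h9⟩
  exact main n 0 0 s₁ (by omega) hw₁ hf ha h14 h9 (by simp)

end PenalizedOptimization

/-! ### One iteration and the main loop. -/

namespace PenalizedOptimization

open RealRAM RealRAM.Op SparseMatrix

variable {m n : ℕ}

/-- The memory holds the matrix `A`, the linear term `g`, the current point `x`, its image under
`A`, and its approximate partition function. -/
structure Point (A : Matrix (Fin m) (Fin n) ℝ) (S : ℕ) (β : ℝ) (g x : Fin n → ℝ) (s : State) :
    Prop where
  entries : s.realArr 3 = value A
  linear : ∀ j : Fin n, s.realArr 6 j = g j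
  coords : ∀ j : Fin n, s.realArr 4 j = x j
  image : ∀ i : Fin m, s.realArr 5 i = (A *ᵥ x) i
  weight : s.real 12 = approxPartition S A β x

open Classical in
/-- The vertex of the cube towards which coordinate `j` moves. -/
noncomputable def direction (A : Matrix (Fin m) (Fin n) ℝ) (S : ℕ) (β δ : ℝ) (g x : Fin n → ℝ)
    (j : Fin n) : ℝ :=
  if 0 < g j * approxPartition S A β x + δ * approxMoment S A β x j then -1 else 1

/-- The point after a step in coordinate `j`. -/
noncomputable def next (A : Matrix (Fin m) (Fin n) ℝ) (S : ℕ) (β α δ : ℝ) (g x : Fin n → ℝ)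
    (j : Fin n) : Fin n → ℝ :=
  Function.update x j (x j + α * (direction A S β δ g x j - x j))

/-- A step in the coordinate held in natural number variable 9. -/
def moveCode : Program :=
  .seq (block [natLoad 10 0 9, natAdd 13 9 2, natLoad 11 0 13, natMul 12 10 2, realSub 13 2 2])
    (.seq momentCode
    (.seq (block [realMul 13 1 13, realLoad 14 6 9, realMul 14 14 12, realAdd 13 14 13,
      realLoad 9 4 9, realMul 10 6 9, natMul 12 10 2])
    (.seq (.ite (.realLT 3 13) (.op (realSub 10 10 5)) (.op (realAdd 10 10 5)))
    (.seq (block [realSub 11 10 9, realStore 4 9 10])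
    (.seq imageCode (.op (natAdd 8 8 2)))))))

/-- The moment loop and the image loop each traverse column `j` once. Arithmetic is exact, so the
invariant `Point` is restored without accumulated error. -/
theorem moveCode_ensures {A : Matrix (Fin m) (Fin n) ℝ} {S T k t : ℕ} {β α δ : ℝ}
    {g x : Fin n → ℝ} {s : State} (h : Globals A S T β α δ s) (hx : Point A S β g x s) {B : ℕ}
    (hw : s.WordsLE B) (hnB : n ≤ B) (j : Fin n) (hk : (column A j).length ≤ k)
    (h9 : s.nat 9 = j) (h8 : s.nat 8 = t) (ht : t < T) :
    Ensures B moveCode s (k * (24 * S + 90) + 45) fun s' =>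
      Globals A S T β α δ s' ∧ Point A S β g (next A S β α δ g x j) s' ∧ s'.nat 8 = t + 1 := by
  have hT : T ≤ B := h.iterations ▸ hw.1 5
  have hlo : columnStart A j ≤ B := h.starts ▸ hw.2 0 j
  refine Ensures.le (T₁ := 1 + 11 + (1 + ((column A j).length * (8 * S + 30) + 1) + (1 + 15 +
    (1 + (1 + 1) + (1 + 5 + (1 + ((column A j).length * (16 * S + 60) + 1) + 1)))))) ?_ (by
      have := Nat.mul_le_mul_right (24 * S + 90) hk
      ring_nf at this ⊢
      omega)
  refine Ensures.seq hw (R := fun s' => Frame 10 13 s s' ∧ s'.realArr = s.realArr ∧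
    s'.nat 10 = columnStart A j ∧ s'.nat 12 = columnStart A j ∧ s'.nat 11 = columnStart A (j + 1) ∧
    s'.real 13 = 0) (Ensures.block hw ?_ ?_) ?_
  · have := j.2
    simp [h.natOne, h9, h.starts]
    omega
  · simp [h.natOne, h9, h.starts]
  rintro s₁ hw₁ ⟨hf₁, ha₁, l10, l12, l11, r13⟩
  have g₁ := h.of_frame hf₁
  refine Ensures.seq hw₁ (momentCode_ensures g₁ hw₁ j (ha₁ ▸ hx.entries) l12 l11 r13) ?_
  rintro s₂ hw₂ ⟨hf₂, ha₂, r13₂⟩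
  have g₂ := g₁.of_frame hf₂
  have f₂ : Frame 10 13 s s₂ := hf₁.trans hf₂.of_le
  have hM : s₂.real 13 = approxMoment S A β x j := by
    rw [r13₂, approxMoment, ha₁]
    simp only [hx.image]
  have n9₂ : s₂.nat 9 = j := (f₂.nat 9 (by norm_num)).trans h9
  have n10₂ := (hf₂.nat 10 (by norm_num)).trans l10
  have n11₂ := (hf₂.nat 11 (by norm_num)).trans l11
  have r12₂ : s₂.real 12 = approxPartition S A β x := (f₂.real 12 (by norm_num)).trans hx.weight
  refine Ensures.seq hw₂ (R := fun s' => Frame 12 9 s₂ s' ∧ s'.realArr = s.realArr ∧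
    s'.nat 12 = columnStart A j ∧ s'.real 9 = x j ∧ s'.real 10 = (1 - α) * x j ∧
    s'.real 12 = approxPartition S A β x ∧
    s'.real 13 = g j * approxPartition S A β x + δ * approxMoment S A β x j)
    (Ensures.block hw₂ ?_ ?_) ?_
  · simp [g₂.natOne, n10₂, hlo]
  · simp [g₂.natOne, g₂.penalty, g₂.stepSize', n10₂, n9₂, ha₂, ha₁, hx.linear, hx.coords, r12₂, hM]
  rintro s₃ hw₃ ⟨hf₃, ha₃, n12, r9, r10, r12, r13⟩
  have g₃ := g₂.of_frame hf₃
  -- Real variable 10 holds `(1 - α) * x j`; subtracting or adding `α` gives the convex combination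
  -- with the chosen endpoint.
  refine Ensures.seq hw₃ (R := fun s' => Frame 12 9 s₂ s' ∧ s'.realArr = s.realArr ∧
    s'.nat 12 = columnStart A j ∧ s'.real 9 = x j ∧
    s'.real 10 = x j + α * (direction A S β δ g x j - x j) ∧
    s'.real 12 = approxPartition S A β x)
    (Ensures.ite hw₃ (fun hlt => Ensures.op hw₃ (by simp) ?_)
      (fun hlt => Ensures.op hw₃ (by simp) ?_)) ?_
  · rw [Test.Holds, g₃.realZero, r13] at hlt
    simp [hf₃, ha₃, n12, r9, r10, r12, g₃.stepSize, direction, hlt]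
    ring
  · rw [Test.Holds, g₃.realZero, r13] at hlt
    simp only [direction, hlt, if_false]
    simp [hf₃, ha₃, n12, r9, r10, r12, g₃.stepSize]
    ring
  rintro s₄ hw₄ ⟨hf₄, ha₄, n12, r9, r10, r12⟩
  have n9₄ := (hf₄.nat 9 (by norm_num)).trans n9₂
  refine Ensures.seq hw₄ (R := fun s' => Frame 12 9 s₂ s' ∧
    (∀ a, a ≠ 4 → s'.realArr a = s.realArr a) ∧
    s'.realArr 4 = Function.update (s.realArr 4) j (x j + α * (direction A S β δ g x j - x j)) ∧
    s'.nat 12 = columnStart A j ∧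
    s'.real 11 = α * (direction A S β δ g x j - x j) ∧
    s'.real 12 = approxPartition S A β x) (Ensures.block hw₄ ?_ ?_) ?_
  · simp
  · simp [hf₄, ha₄, n12, r9, r10, r12, n9₄]
    intro a ha ha'
    exact absurd ha' ha
  rintro s₅ hw₅ ⟨hf₅, ha₅, ha4, n12, r11, r12⟩
  have g₅ := g₂.of_frame hf₅
  have n11₅ := (hf₅.nat 11 (by norm_num)).trans n11₂
  refine Ensures.seq hw₅ (imageCode_ensures g₅ hw₅ j ((ha₅ 3 (by norm_num)).trans hx.entries)
    n12 n11₅ ?_) ?_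
  · rw [r12, approxPartition, ha₅ 5 (by norm_num)]
    simp only [hx.image]
  rintro s₆ hw₆ ⟨hf₆, ha₆, hz, r12₆⟩
  have g₆ := g₅.of_frame hf₆
  have n8₆ : s₆.nat 8 = t := ((hf₆.nat 8 (by norm_num)).trans (hf₅.nat 8 (by norm_num))).trans
    ((f₂.nat 8 (by norm_num)).trans h8)
  have himg : ∀ i : Fin m, s₆.realArr 5 i = (A *ᵥ next A S β α δ g x j) i := fun i => by
    rw [hz, ha₅ 5 (by norm_num), hx.image, r11, next, mulVec_update]
  refine Ensures.op hw₆ ?_ ⟨g₆.of_frame (L := 8) (R := 8) (by simp), ⟨?_, ?_, ?_, ?_, ?_⟩, ?_⟩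
  · simp [g₆.natOne, n8₆]; omega
  · simp [ha₆, ha₅, hx.entries]
  · simp [ha₆, ha₅, hx.linear]
  · intro i
    simp only [Op.exec, State.realArr_setNat]
    rw [ha₆ 4 (by norm_num), ha4, next]
    by_cases hi : i = j
    · subst hi; simp
    · rw [Function.update_of_ne hi, Function.update_of_ne (Fin.val_ne_of_ne hi), hx.coords]
  · simpa using himg
  · simp only [Op.exec, State.real_setNat]
    rw [r12₆, approxPartition]
    simp only [himg]
  · simp [g₆.natOne, n8₆]

/-- One iteration: a step in a random coordinate. -/
def stepCode : Program := .seq sampleCode moveCode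

theorem stepCode_halts {A : Matrix (Fin m) (Fin n) ℝ} {S T k t : ℕ} {β α δ : ℝ}
    {g x : Fin n → ℝ} {s : State} (h : Globals A S T β α δ s) (hx : Point A S β g x s) {B : ℕ}
    (hw : s.WordsLE B) (hn : 0 < n) (hnB : n + 1 ≤ B) (hk : ∀ j, (column A j).length ≤ k)
    (h8 : s.nat 8 = t) (ht : t < T) {E : State → Prop} {K : List Program} {T' : ℕ} {φ : Fin n → ℝ}
    (hK : ∀ s' j, s'.WordsLE B → Globals A S T β α δ s' →
      Point A S β g (next A S β α δ g x j) s' → s'.nat 8 = t + 1 → Halts B E (K, s') T' (φ j)) :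
    Halts B E (stepCode :: K, s) (20 * n + k * (24 * S + 90) + 56 + T') ((∑ j, φ j) / n) := by
  have e : ∑ j, φ j = ∑ i ∈ Finset.range n, (fun i => if hi : i < n then φ ⟨i, hi⟩ else 0) i := by
    rw [Finset.sum_range]; simp
  rw [e, show 20 * n + k * (24 * S + 90) + 56 + T' =
    20 * n + 10 + (k * (24 * S + 90) + 45 + T') + 1 by ring]
  refine Halts.of_step_eq_pure (by rw [stepCode, step]) hw ?_
  refine sampleCode_halts hn hw h.dim h.natOne h.realOne hnB ?_
  intro s₁ j hw₁ hf₁ ha₁ hj h9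
  rw [dif_pos hj]
  have hx₁ : Point A S β g x s₁ := ⟨ha₁ ▸ hx.entries, ha₁ ▸ hx.linear, ha₁ ▸ hx.coords,
    ha₁ ▸ hx.image, (hf₁.real 12 (by norm_num)).trans hx.weight⟩
  exact moveCode_ensures (h.of_frame hf₁) hx₁ hw₁ (by omega) ⟨j, hj⟩ (hk _) h9
    ((hf₁.nat 8 (by norm_num)).trans h8) ht E K T' _ fun s' hw' H => hK s' _ hw' H.1 H.2.1 H.2.2

theorem next_mem_cube {A : Matrix (Fin m) (Fin n) ℝ} {S : ℕ} {β α δ : ℝ} {g x : Fin n → ℝ}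
    (hα : 0 ≤ α) (hα1 : α ≤ 1) (hx : x ∈ cube n) (j : Fin n) :
    next A S β α δ g x j ∈ cube n := by
  intro i
  rw [next]
  by_cases hi : i = j
  · subst hi
    rw [Function.update_self]
    have := hx i
    have h1 : direction A S β δ g x i ∈ Set.Icc (-1 : ℝ) 1 := by
      rw [direction]; split_ifs <;> simp
    constructor <;> nlinarith [this.1, this.2, h1.1, h1.2]
  · rw [Function.update_of_ne hi]; exact hx i

/-- The numerical conditions on the parameters of the algorithm. -/
structure Parameters (n S : ℕ) (β α κ l C : ℝ) : Prop where
  scale_pos : 0 < β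
  step_pos : 0 < α
  step_le : α ≤ 1
  step_scale : 2 * α * β ≤ 1
  rate_nonneg : 0 ≤ l
  step_rate : 10 * α * l ≤ 1
  error_nonneg : 0 ≤ κ
  scale_le : β * n ≤ 2 ^ S
  error : (β * n) ^ 2 / 2 ^ S ≤ κ
  level : n * (2 * (4 * κ) + 4 * α * β + 100 * l * α) ≤ C

theorem sum_exp_next_le {A : Matrix (Fin m) (Fin n) ℝ} (hA : ∀ i j, |A i j| ≤ 1) {S : ℕ}
    {β α δ κ l θ C : ℝ} (hP : Parameters n S β α κ l C) (hn : 0 < n) (hδ : 0 ≤ δ) (hδ1 : δ ≤ 1)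
    (hθ : 0 ≤ θ) (hθl : θ ≤ l) {g x y : Fin n → ℝ} (hg : ∀ j, |g j| ≤ 3) (hx : x ∈ cube n)
    (hy : y ∈ cube n) :
    (∑ j, Real.exp (θ * (soft A β δ g (next A S β α δ g x j) - soft A β δ g y - C))) / n ≤
      Real.exp (θ * (1 - α / n) * (soft A β δ g x - soft A β δ g y - C)) := by
  have hα := hP.step_pos
  refine sum_exp_update_le hA (γ := 4 * κ) hn (by linarith [hP.error_nonneg]) hP.scale_pos hδ hδ1
    hα hP.step_scale hθ ?_ hx hy (fun j => abs_slope_le hA hδ hδ1 x j (hg j)) (fun j => ?_) ?_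
  · refine le_trans ?_ hP.step_rate; gcongr
  · have := slope_sign hA hP.scale_pos hδ hδ1 hP.scale_le hP.error hx j (hg j)
    rw [direction]
    split_ifs with h
    · exact Or.inl ⟨rfl, this.1 h⟩
    · exact Or.inr ⟨rfl, this.2 h⟩
  · refine le_trans ?_ hP.level; gcongr

/-- Induction on the number `r` of remaining steps, for all current points. The success bound is a
function of the current point, and averaging it over `j` is exactly the exponential moment
controlled by `sum_exp_next_le`. -/
theorem loop_halts {A : Matrix (Fin m) (Fin n) ℝ} (hA : ∀ i j, |A i j| ≤ 1) {S T k B : ℕ}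
    {β α δ κ l C D : ℝ} (hP : Parameters n S β α κ l C) (hn : 0 < n) (hδ : 0 ≤ δ) (hδ1 : δ ≤ 1)
    {g y : Fin n → ℝ} (hg : ∀ j, |g j| ≤ 3) (hy : y ∈ cube n)
    (hnB : n + 1 ≤ B) (hk : ∀ j, (column A j).length ≤ k) {E : State → Prop}
    (hE : ∀ x s, x ∈ cube n → Point A S β g x s → soft A β δ g x - soft A β δ g y ≤ D → E s) :
    ∀ r t s x, t + r = T → s.WordsLE B → Globals A S T β α δ s → Point A S β g x s →
      x ∈ cube n → s.nat 8 = t →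
      Halts B E ([.loop (.natLT 8 5) stepCode], s) (r * (20 * n + k * (24 * S + 90) + 57) + 1)
        (1 - Real.exp (l * (1 - α / n) ^ r * (soft A β δ g x - soft A β δ g y - C) - l * (D - C)))
      := by
  have hn' : (0 : ℝ) < n := Nat.cast_pos.2 hn
  have hq : 0 ≤ 1 - α / n := by
    rw [sub_nonneg, div_le_one hn']
    exact hP.step_le.trans (by exact_mod_cast hn)
  have hq1 : 1 - α / n ≤ 1 := by
    have : 0 ≤ α / n := div_nonneg hP.step_pos.le hn'.le
    linarith
  intro r
  induction r with
  | zero =>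
    intro t s x ht hw h hx hxc h8
    rw [zero_mul, zero_add]
    refine Halts.of_step_eq_pure
      (by rw [step, if_neg (by rw [Test.Holds, h.iterations]; omega)]) hw
      (Halts.nil hw (fun hpos => hE x s hxc hx ?_) ?_)
    -- With no steps left, the bound is positive only if `l * (F x - F y - D) < 0`, which forces the
    -- excess below `D`.
    · by_contra hlt
      rw [not_le] at hlt
      rw [sub_pos, Real.exp_lt_one_iff] at hpos
      have := mul_nonneg hP.rate_nonneg (sub_nonneg.2 hlt.le)
      rw [pow_zero, mul_one] at hpos
      linarith
    · linarith [Real.exp_pos (l * (1 - α / n) ^ 0 * (soft A β δ g x - soft A β δ g y - C) -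
        l * (D - C))]
  | succ r ih =>
    intro t s x ht hw h hx hxc h8
    rw [show (r + 1) * (20 * n + k * (24 * S + 90) + 57) + 1 =
      20 * n + k * (24 * S + 90) + 56 + (r * (20 * n + k * (24 * S + 90) + 57) + 1) + 1 by ring]
    refine Halts.of_step_eq_pure
      (by rw [step, if_pos (by rw [Test.Holds, h.iterations]; omega)]) hw ?_
    refine (stepCode_halts h hx hw hn hnB hk h8 (by omega) fun s' j hw' h' hx' h8' =>
      ih (t + 1) s' (next A S β α δ g x j) (by omega) hw' h' hx'
        (next_mem_cube hP.step_pos.le hP.step_le hxc j) h8').mono le_rfl ?_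
    -- The rate belongs to the `r` steps that follow this one; the present step supplies one more
    -- factor `1 - α / n`.
    have key := sum_exp_next_le hA hP hn hδ hδ1 (θ := l * (1 - α / n) ^ r)
      (mul_nonneg hP.rate_nonneg (pow_nonneg hq r))
      (mul_le_of_le_one_right hP.rate_nonneg (pow_le_one₀ hq hq1)) hg hxc hy
    rw [Finset.sum_sub_distrib, Finset.sum_const, Finset.card_univ, Fintype.card_fin,
      nsmul_eq_mul, mul_one, sub_div, div_self hn'.ne']
    refine sub_le_sub_left ?_ _
    simp only [Real.exp_sub]
    rw [← Finset.sum_div, div_right_comm, pow_succ, ← mul_assoc]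
    gcongr

end PenalizedOptimization

/-! ### Initialization: binary length, square root, parameters, linear term. -/

namespace PenalizedOptimization

open RealRAM RealRAM.Op SparseMatrix

variable {m n : ℕ}

/-- Stores the binary length of the dimension in natural number variable 3. -/
def sizeCode : Program :=
  .seq (block [natConst 2 1, realOfNat 2 2, natAdd 10 0 2, natConst 11 1, natConst 3 0])
    (.loop (.natLT 11 10) (block [natAdd 11 11 11, natAdd 3 3 2]))

theorem sizeCode_ensures {B : ℕ} {s : State} (hw : s.WordsLE B) (h0 : s.nat 0 = n) (hn : 0 < n)
    (hB : 2 * n + 1 ≤ B) :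
    Ensures B sizeCode s (6 * Nat.size n + 13) fun s' => Frame 2 2 s s' ∧ s'.realArr = s.realArr ∧
      s'.nat 2 = 1 ∧ s'.nat 3 = Nat.size n ∧ s'.real 2 = 1 ∧ s'.real 3 = s.real 3 := by
  refine (Ensures.seq (T₁ := 11) (T₂ := Nat.size n * (5 + 1) + 1) (R := fun s' => Frame 2 2 s s' ∧
    s'.realArr = s.realArr ∧ s'.nat 2 = 1 ∧ s'.real 2 = 1 ∧ s'.real 3 = s.real 3 ∧
    s'.nat 10 = n + 1 ∧ s'.nat 11 = 1 ∧ s'.nat 3 = 0) hw (Ensures.block hw ?_ ?_) ?_).le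
      (by omega)
  · simp [h0]; omega
  · simp [h0]
  rintro s₁ hw₁ ⟨hf, ha, h2, hr2, hr3, h10, h11, h3⟩
  refine (Ensures.loop (fun k s' => Frame 2 2 s s' ∧ s'.realArr = s.realArr ∧ s'.nat 2 = 1 ∧
    s'.real 2 = 1 ∧ s'.real 3 = s.real 3 ∧ s'.nat 10 = n + 1 ∧ s'.nat 11 = 2 ^ k ∧ s'.nat 3 = k)
    (Nat.size n) hw₁ ?_ ?_ ?_).mono le_rfl ?_
  · simp [*]
  · rintro k hk s' hw' ⟨hf', ha', h2', hr2', hr3', h10', h11', h3'⟩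
    -- The loop compares with `n + 1`, so its strict test reads `2 ^ k ≤ n`, that is `k < n.size`.
    have h2k : 2 ^ k ≤ n := Nat.lt_size.1 hk
    have hkn : k < 2 ^ k := Nat.lt_two_pow_self
    refine ⟨by rw [Test.Holds, h10', h11']; omega, Ensures.block hw' ?_ ?_⟩
    · simp [h11', h3', h2']; omega
    · simp [*]; ring
  · rintro s' ⟨-, -, -, -, -, h10', h11', -⟩
    have : n < 2 ^ Nat.size n := Nat.lt_size_self n
    rw [Test.Holds, h10', h11']; omega
  · rintro s' - ⟨hf', ha', h2', hr2', hr3', h10', h11', h3'⟩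
    exact ⟨hf', ha', h2', h3', hr2', hr3'⟩

/-- A Heron step brings an upper bound of the square root of `a` closer by a factor of two. -/
theorem heron_step {a r e : ℝ} (ha : 0 < a) (h1 : √a ≤ r) (h2 : r ≤ √a + e) :
    √a ≤ (r + a / r) / 2 ∧ (r + a / r) / 2 ≤ √a + e / 2 := by
  have hs := Real.sqrt_pos.2 ha
  have hr : 0 < r := hs.trans_le h1
  have hsq := Real.sq_sqrt ha.le
  -- The new error equals `(r - √a) ^ 2 / (2 * r)`. One factor `r - √a` is at most `e`, the other at
  -- most `r`.
  have e1 : (r + a / r) / 2 - √a = (r - √a) ^ 2 / (2 * r) := by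
    rw [show a / r = √a ^ 2 / r by rw [hsq]]
    field_simp
    ring
  have h3 : (r - √a) ^ 2 / (2 * r) ≤ e / 2 := by
    rw [div_le_iff₀ (by positivity)]
    nlinarith
  have h4 : 0 ≤ (r - √a) ^ 2 / (2 * r) := by positivity
  constructor <;> linarith

/-- Stores an upper approximation of the square root of the dimension in real variable 4. -/
def sqrtCode : Program :=
  .seq (block [natConst 12 16, natMul 12 12 0, natConst 13 0, realOfNat 10 0, realOfNat 4 0,
      realAdd 11 2 2])
    (.loop (.natLT 13 12) (block [realDiv 12 10 4, realAdd 4 4 12, realDiv 4 4 11,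
      natAdd 13 13 2]))

/-- The iteration starts from `n`, whose error is at most `n`, and halves the error `16 * n` times.
Linear time is affordable here and gives far more precision than needed. -/
theorem sqrtCode_ensures {B : ℕ} {s : State} (hw : s.WordsLE B) (h0 : s.nat 0 = n) (hn : 0 < n)
    (h2 : s.nat 2 = 1) (hr2 : s.real 2 = 1) (hB : 16 * n ≤ B) :
    Ensures B sqrtCode s (160 * n + 15) fun s' => Frame 4 4 s s' ∧ s'.realArr = s.realArr ∧
      √(n : ℝ) ≤ s'.real 4 ∧ s'.real 4 ≤ √(n : ℝ) + n / 2 ^ (16 * n) := by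
  have hn1 : (1 : ℝ) ≤ n := Nat.one_le_cast.2 hn
  refine (Ensures.seq (T₁ := 13) (T₂ := (16 * n) * (9 + 1) + 1) (R := fun s' => Frame 4 4 s s' ∧
    s'.realArr = s.realArr ∧ s'.nat 12 = 16 * n ∧ s'.nat 13 = 0 ∧ s'.real 10 = n ∧ s'.real 4 = n ∧
    s'.real 11 = 2) hw (Ensures.block hw ?_ ?_) ?_).le (by omega)
  · simp [h0]; omega
  · simp [h0, hr2]; norm_num
  rintro s₁ hw₁ ⟨hf, ha, h12, h13, hr10, hr4, hr11⟩
  refine (Ensures.loop (fun k s' => Frame 4 4 s s' ∧ s'.realArr = s.realArr ∧ s'.nat 12 = 16 * n ∧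
    s'.nat 13 = k ∧ s'.real 10 = n ∧ s'.real 11 = 2 ∧ √(n : ℝ) ≤ s'.real 4 ∧
    s'.real 4 ≤ √(n : ℝ) + n / 2 ^ k) (16 * n) hw₁ ?_ ?_ ?_).mono le_rfl ?_
  · refine ⟨hf, ha, h12, h13, hr10, hr11, ?_, ?_⟩
    · rw [hr4]; exact Real.sqrt_le_iff.2 ⟨by linarith, by nlinarith⟩
    · rw [hr4]; simp
  · rintro k hk s' hw' ⟨hf', ha', h12', h13', hr10', hr11', h1', h2'⟩
    have e2 := hf'.nat 2 (by norm_num)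
    refine ⟨by rw [Test.Holds, h12', h13']; exact hk, Ensures.block hw' ?_ ?_⟩
    · simp [h13', e2, h2]; omega
    · have := heron_step (by linarith) h1' h2'
      refine ⟨by simpa using hf', by simpa using ha', by simpa using h12', ?_, by simpa using hr10',
        by simpa using hr11', ?_, ?_⟩
      · simp [h13', e2, h2]
      · simpa [hr10', hr11'] using this.1
      · rw [pow_succ, ← div_div]
        simpa [hr10', hr11'] using this.2
  · rintro s' ⟨-, -, h12', h13', -⟩
    rw [Test.Holds, h12', h13']; omega
  · rintro s' - ⟨hf', ha', -, -, -, -, h1', h2'⟩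
    exact ⟨hf', ha', h1', h2'⟩

/-- Stores a power of two in real variable 10. -/
def powerCode : Program :=
  .seq (block [natConst 14 64, natMul 4 14 3, natConst 13 0, realOfNat 10 2])
    (.loop (.natLT 13 4) (block [realAdd 10 10 10, natAdd 13 13 2]))

/-- The power is built up by doubling a real number, so it is exempt from the word bound `B`. -/
theorem powerCode_ensures {B l : ℕ} {s : State} (hw : s.WordsLE B) (h2 : s.nat 2 = 1)
    (h3 : s.nat 3 = l) (hB : 64 * l ≤ B) (hB' : 64 ≤ B) :
    Ensures B powerCode s (384 * l + 11) fun s' => Frame 4 5 s s' ∧ s'.realArr = s.realArr ∧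
      s'.nat 4 = 64 * l ∧ s'.real 10 = 2 ^ (64 * l) := by
  refine (Ensures.seq (T₁ := 9) (T₂ := (64 * l) * (5 + 1) + 1) (R := fun s' => Frame 4 5 s s' ∧
    s'.realArr = s.realArr ∧ s'.nat 4 = 64 * l ∧ s'.nat 13 = 0 ∧ s'.real 10 = 1) hw
    (Ensures.block hw ?_ ?_) ?_).le (by omega)
  · simp [h3, hB, hB']
  · simp [h3, h2]
  rintro s₁ hw₁ ⟨hf, ha, h4, h13, hr10⟩
  refine (Ensures.loop (fun k s' => Frame 4 5 s s' ∧ s'.realArr = s.realArr ∧ s'.nat 4 = 64 * l ∧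
    s'.nat 13 = k ∧ s'.real 10 = 2 ^ k) (64 * l) hw₁ ?_ ?_ ?_).mono le_rfl ?_
  · simp [*]
  · rintro k hk s' hw' ⟨hf', ha', h4', h13', hr10'⟩
    have e2 := hf'.nat 2 (by norm_num)
    refine ⟨by rw [Test.Holds, h4', h13']; exact hk, Ensures.block hw' ?_ ?_⟩
    · simp [h13', e2, h2]; omega
    · simp [*]; ring
  · rintro s' ⟨-, -, h4', h13', -⟩
    rw [Test.Holds, h4', h13']; omega
  · rintro s' - ⟨hf', ha', h4', -, hr⟩
    exact ⟨hf', ha', h4', hr⟩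

/-- Computes the parameters of the main loop. -/
def parameterCode : Program :=
  block [natMul 10 3 3, natMul 10 10 10, natMul 11 10 3, natMul 12 10 11, natMul 13 11 11,
    natConst 14 16384, natMul 12 12 14, realOfNat 11 12, realDiv 5 2 11, realSub 6 2 5,
    natConst 14 64, natMul 11 14 11, realOfNat 11 11, realDiv 11 11 4, realDiv 7 11 10,
    natConst 14 262144, natMul 13 13 14, natMul 5 13 0, natAdd 13 1 1, natAdd 13 13 2,
    realOfNat 12 13]

theorem parameterCode_ensures {A : Matrix (Fin m) (Fin n) ℝ} {B l : ℕ} {ρ₀ δ r : ℝ} {s : State}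
    (hw : s.WordsLE B) (h0 : s.nat 0 = n) (hn : 0 < n) (hl : 0 < l) (h1 : s.nat 1 = m)
    (h2 : s.nat 2 = 1) (h3 : s.nat 3 = l) (h4 : s.nat 4 = 64 * l) (hr0 : s.real 0 = ρ₀)
    (hr1 : s.real 1 = δ) (hr2 : s.real 2 = 1) (hr3 : s.real 3 = 0) (hr4 : s.real 4 = r)
    (hr10 : s.real 10 = 2 ^ (64 * l)) (hcs : s.natArr 0 = columnStart A)
    (hri : s.natArr 1 = rowIndex A) (hB : l ^ 10 * 262144 * n ≤ B) (hB' : 2 * m + 1 ≤ B) :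
    Ensures B parameterCode s 43 fun s' => s'.realArr = s.realArr ∧ s'.real 0 = ρ₀ ∧
      s'.real 4 = r ∧ s'.real 12 = 1 + 2 * m ∧
      Globals A (64 * l) (l ^ 10 * 262144 * n) (64 * l ^ 5 / r) (1 / (16384 * l ^ 9)) δ s' := by
  -- The intermediate integers in `l` alone are at most `l ^ i * 262144` with `i ≤ 10`; the bound
  -- assumed for the number of iterations covers them.
  have hpow : ∀ k, k ≤ 10 → l ^ k * 262144 ≤ B := fun k hk => by
    refine le_trans ?_ hB
    exact (Nat.mul_le_mul_right _ (Nat.pow_le_pow_right hl hk)).trans (Nat.le_mul_of_pos_right _ hn)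
  have p2 : l * l * 262144 ≤ B := by simpa [pow_two] using hpow 2 (by norm_num)
  have p4 : l * l * (l * l) * 262144 ≤ B := by
    convert hpow 4 (by norm_num) using 2; ring
  have p5 : l * l * (l * l) * l * 262144 ≤ B := by
    convert hpow 5 (by norm_num) using 2; ring
  have p9 : l * l * (l * l) * (l * l * (l * l) * l) * 262144 ≤ B := by
    convert hpow 9 (by norm_num) using 2; ring
  have p10 : l * l * (l * l) * l * (l * l * (l * l) * l) * 262144 ≤ B := by
    convert hpow 10 (by norm_num) using 2; ring
  have pT : l * l * (l * l) * l * (l * l * (l * l) * l) * 262144 * n ≤ B := by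
    convert hB using 3; ring
  have p0 : 262144 ≤ B := by simpa using hpow 0 (by norm_num)
  refine (Ensures.block hw ?_ ?_)
  · simp [h0, h1, h2, h3]
    refine ⟨?_, ?_, ?_, ?_, ?_, ?_, ?_, ?_, ?_, ?_, ?_, ?_, ?_, ?_⟩ <;> linarith
  · refine ⟨by simp, by simpa using hr0, by simpa using hr4, ?_,
      ⟨by simpa using h0, by simpa using h2, by simpa using h4, ?_, by simpa using hr1,
      by simpa using hr2, by simpa using hr3, ?_, ?_, ?_, by simpa using hcs, by simpa using hri⟩⟩
    · simp [h1, h2]; ring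
    · simp [h0, h3]; left; ring
    · simp [hr2, h3]; ring
    · simp [hr2, h3]; ring
    · simp [h3, hr4, hr10]; ring

/-- Adds to real variable 13 the linear term of a column. -/
def linearBody : Program :=
  block [natLoad 13 1 12, realLoad 14 3 12, realLoad 15 1 13, realLoad 16 2 13, realSub 15 15 16,
    realMul 14 14 15, realAdd 13 13 14, natAdd 12 12 2]

/-- Stores the linear term of the objective in real array 6. -/
def linearCode : Program :=
  .seq (block [natConst 9 0])
    (.loop (.natLT 9 0)
      (.seq (block [natLoad 10 0 9, natAdd 13 9 2, natLoad 11 0 13, natMul 12 10 2, realLoad 13 0 9,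
        realMul 13 0 13, realDiv 13 13 4, realSub 13 3 13])
      (.seq (.loop (.natLT 12 11) linearBody) (block [realStore 6 9 13, natAdd 9 9 2]))))

/-- The linear term of the objective, with an approximation `r` of `√n`. -/
noncomputable def linearTerm (A : Matrix (Fin m) (Fin n) ℝ) (ρ₀ : ℝ) (ρp ρm : Fin m → ℝ)
    (v : EuclideanSpace ℝ (Fin n)) (r : ℝ) (j : Fin n) : ℝ :=
  -(ρ₀ * v.ofLp j / r) + ∑ i, A i j * (ρp i - ρm i)

@[simp] theorem toArray_fin {d : ℕ} (x : Fin d → ℝ) (i : Fin d) : toArray x i = x i := by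
  simp [toArray]

theorem linearBody_ensures {A : Matrix (Fin m) (Fin n) ℝ} {S T k B : ℕ} {β α δ c : ℝ}
    {ρp ρm : Fin m → ℝ} {s : State} (h : Globals A S T β α δ s) (hw : s.WordsLE B)
    (j : Fin n) (hk : (column A j).length ≤ k)
    (ha1 : s.realArr 1 = toArray ρp) (ha2 : s.realArr 2 = toArray ρm) (ha3 : s.realArr 3 = value A)
    (hlo : s.nat 12 = columnStart A j) (hhi : s.nat 11 = columnStart A (j + 1))
    (hr : s.real 13 = c) :
    Ensures B (.loop (.natLT 12 11) linearBody) s (k * 18 + 1) fun s' =>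
      Frame 12 13 s s' ∧ s'.realArr = s.realArr ∧
      s'.real 13 = c + ∑ i, A i j * (ρp i - ρm i) := by
  have hB : columnStart A (j + 1) ≤ B := hhi ▸ hw.1 11
  rw [columnStart_succ] at hhi hB
  refine (Ensures.loop (T := 17) (fun q s' => Frame 12 13 s s' ∧ s'.realArr = s.realArr ∧
    s'.nat 12 = columnStart A j + q ∧ s'.real 13 = c + ∑ p ∈ Finset.range q,
      value A (columnStart A j + p) * (toArray ρp (rowIndex A (columnStart A j + p)) -
        toArray ρm (rowIndex A (columnStart A j + p))))
    (column A j).length hw ?_ ?_ ?_).mono (by gcongr) ?_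
  · simp [*]
  · rintro q hq s₁ hw₁ ⟨hf₁, a₁, hp₁, hr₁⟩
    have g₁ := h.of_frame hf₁
    have e11 := hf₁.nat 11 (by norm_num)
    refine ⟨by simp [Test.Holds, *], Ensures.block hw₁ ?_ ?_⟩
    · simp [g₁.natOne, hp₁]; omega
    · simp [*, g₁.rows, g₁.natOne, Finset.sum_range_succ, add_assoc]
  · rintro s₁ ⟨hf₁, -, hp₁, -⟩
    have e11 := hf₁.nat 11 (by norm_num)
    simp [Test.Holds, *]
  · rintro s' - ⟨hf, a, -, hr⟩
    refine ⟨hf, a, hr.trans ?_⟩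
    rw [sum_column A j fun i => toArray ρp i - toArray ρm i]
    simp

theorem linearCode_ensures {A : Matrix (Fin m) (Fin n) ℝ} {S T k B : ℕ} {β α δ ρ₀ r : ℝ}
    {ρp ρm : Fin m → ℝ} {v : EuclideanSpace ℝ (Fin n)} {s : State} (h : Globals A S T β α δ s)
    (hw : s.WordsLE B) (hnB : n + 1 ≤ B) (hk : ∀ j, (column A j).length ≤ k)
    (hr0 : s.real 0 = ρ₀) (hr4 : s.real 4 = r) (ha0 : s.realArr 0 = toArray v.ofLp)
    (ha1 : s.realArr 1 = toArray ρp) (ha2 : s.realArr 2 = toArray ρm)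
    (ha3 : s.realArr 3 = value A) :
    Ensures B linearCode s (n * (k * 18 + 26) + 5) fun s' => Frame 9 13 s s' ∧
      (∀ a, a ≠ 6 → s'.realArr a = s.realArr a) ∧
      ∀ j : Fin n, s'.realArr 6 j = linearTerm A ρ₀ ρp ρm v r j := by
  refine (Ensures.seq (T₁ := 3) (T₂ := n * (k * 18 + 25 + 1) + 1) (R := fun s' => Frame 9 13 s s' ∧
    s'.realArr = s.realArr ∧ s'.nat 9 = 0) hw (Ensures.block hw ?_ ?_) ?_).le
      (by rw [show k * 18 + 25 + 1 = k * 18 + 26 by ring]; omega)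
  · simp
  · simp
  rintro s₁ hw₁ ⟨hf, ha, h9⟩
  refine (Ensures.loop (fun q s' => Frame 9 13 s s' ∧ (∀ a, a ≠ 6 → s'.realArr a = s.realArr a) ∧
    s'.nat 9 = q ∧ ∀ j : Fin n, (j : ℕ) < q → s'.realArr 6 j = linearTerm A ρ₀ ρp ρm v r j) n hw₁
    ?_ ?_ ?_).mono le_rfl ?_
  · simp [*]
  · rintro q hq s₂ hw₂ ⟨hf₂, ha₂, h9₂, hl₂⟩
    have g₂ := h.of_frame hf₂
    refine ⟨by rw [Test.Holds, h9₂, g₂.dim]; exact hq, ?_⟩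
    have hlo : columnStart A q ≤ B := g₂.starts ▸ hw₂.2 0 q
    have e0 := hf₂.real 0 (by norm_num)
    have e4 := hf₂.real 4 (by norm_num)
    refine (Ensures.seq (T₁ := 17) (T₂ := 1 + (k * 18 + 1) + 5) (R := fun s' => Frame 10 13 s₂ s' ∧
      s'.realArr = s₂.realArr ∧ s'.nat 12 = columnStart A q ∧ s'.nat 11 = columnStart A (q + 1) ∧
      s'.real 13 = -(ρ₀ * toArray v.ofLp q / r)) hw₂ (Ensures.block hw₂ ?_ ?_) ?_).le (by omega)
    · simp [g₂.natOne, h9₂, g₂.starts]; omega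
    · simp [g₂.natOne, h9₂, g₂.starts, g₂.realZero, e0, hr0, e4, hr4, ha₂, ha0]
    rintro s₃ hw₃ ⟨hf₃, ha₃, h12, h11, hr13⟩
    have g₃ := g₂.of_frame hf₃
    refine Ensures.seq hw₃ (linearBody_ensures (ρp := ρp) (ρm := ρm) g₃ hw₃ ⟨q, hq⟩ (hk _) ?_ ?_ ?_
      h12 h11 hr13) ?_
    · rw [ha₃, ha₂ 1 (by norm_num), ha1]
    · rw [ha₃, ha₂ 2 (by norm_num), ha2]
    · rw [ha₃, ha₂ 3 (by norm_num), ha3]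
    rintro s₄ hw₄ ⟨hf₄, ha₄, hr13'⟩
    have g₄ := g₃.of_frame hf₄
    have n9 := (hf₄.nat 9 (by norm_num)).trans ((hf₃.nat 9 (by norm_num)).trans h9₂)
    have f₄ : Frame 9 13 s s₄ := hf₂.trans (hf₃.of_le.trans hf₄.of_le)
    refine Ensures.block hw₄ ?_ ?_
    · simp [n9, g₄.natOne]; omega
    · refine ⟨by simpa using f₄, fun a ha => ?_, by simp [n9, g₄.natOne], fun j hj => ?_⟩
      · simp [ha, ha₄, ha₃, ha₂]
      · simp only [execs, Op.exec, State.realArr_setNat, State.realArr_setRealArr, if_true, n9]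
        by_cases hjq : (j : ℕ) = q
        · subst hjq
          rw [Function.update_self, hr13', linearTerm, toArray_fin]
        · rw [Function.update_of_ne hjq, ha₄, ha₃, hl₂ j (by omega)]
  · rintro s' ⟨hf', -, h9', -⟩
    rw [Test.Holds, h9', (h.of_frame hf').dim]; omega
  · rintro s' - ⟨hf', ha', -, hl⟩
    exact ⟨hf', ha', fun j => hl j j.2⟩

/-! ### The complete program. -/

/-- The complete algorithm. -/
def optimize : Program :=
  .seq sizeCode (.seq sqrtCode (.seq powerCode (.seq parameterCode (.seq linearCode
    (.seq (block [natConst 8 0]) (.loop (.natLT 8 5) stepCode))))))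

theorem input_wordsLE {A : Matrix (Fin m) (Fin n) ℝ} {ρ₀ δ : ℝ} {ρp ρm : Fin m → ℝ}
    {v : EuclideanSpace ℝ (Fin n)} {B : ℕ} (hn : n ≤ B) (hm : m ≤ B) (hnm : n * m ≤ B) :
    (input A ρ₀ ρp ρm v δ).WordsLE B := by
  constructor
  · intro a
    rcases a with _ | _ | a
    · exact hn
    · exact hm
    · exact Nat.zero_le _
  · intro a i
    rcases a with _ | _ | a
    · exact (columnStart_le A i).trans hnm
    · exact (rowIndex_le A i).trans hm
    · exact Nat.zero_le _

/-- Of the computed square root `r` only an enclosing interval is known, so the hypotheses range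
over every `r` in it. Arrays 4 and 5 are zero in the input memory and thus already represent the
starting point `0` and its image. -/
theorem optimize_halts {A : Matrix (Fin m) (Fin n) ℝ} (hA : ∀ i j, |A i j| ≤ 1) {k B : ℕ}
    {ρ₀ δ κ l C D : ℝ} {ρp ρm : Fin m → ℝ} {v : EuclideanSpace ℝ (Fin n)}
    (hn : 0 < n) (hδ : 0 ≤ δ) (hδ1 : δ ≤ 1) (hk : ∀ j, (column A j).length ≤ k)
    (hP : ∀ r, √(n : ℝ) ≤ r → r ≤ √(n : ℝ) + n / 2 ^ (16 * n) →
      Parameters n (64 * n.size) (64 * n.size ^ 5 / r) (1 / (16384 * n.size ^ 9)) κ l C)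
    {y : Fin n → ℝ} (hy : y ∈ cube n)
    (hg : ∀ r, √(n : ℝ) ≤ r → ∀ j, |linearTerm A ρ₀ ρp ρm v r j| ≤ 3)
    (hB : n.size ^ 10 * 262144 * n ≤ B) (hm : 2 * m + 1 ≤ B) (hnm : n * m ≤ B)
    {E : State → Prop} {p : ℝ}
    (hE : ∀ r, √(n : ℝ) ≤ r → r ≤ √(n : ℝ) + n / 2 ^ (16 * n) → ∀ x s, x ∈ cube n →
      (∀ j : Fin n, s.realArr 4 j = x j) →
      soft A (64 * n.size ^ 5 / r) δ (linearTerm A ρ₀ ρp ρm v r) x -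
        soft A (64 * n.size ^ 5 / r) δ (linearTerm A ρ₀ ρp ρm v r) y ≤ D → E s)
    (hp : ∀ r, √(n : ℝ) ≤ r → r ≤ √(n : ℝ) + n / 2 ^ (16 * n) →
      p ≤ 1 - Real.exp (l * (1 - 1 / (16384 * n.size ^ 9) / n) ^ (n.size ^ 10 * 262144 * n) *
        (soft A (64 * n.size ^ 5 / r) δ (linearTerm A ρ₀ ρp ρm v r) 0 -
          soft A (64 * n.size ^ 5 / r) δ (linearTerm A ρ₀ ρp ρm v r) y - C) - l * (D - C))) :
    Halts B E ([optimize], input A ρ₀ ρp ρm v δ)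
      (390 * n.size + 160 * n + n * (k * 18 + 26) + 102 +
        n.size ^ 10 * 262144 * n * (20 * n + k * (24 * (64 * n.size) + 90) + 57)) p := by
  have hl : 0 < n.size := Nat.size_pos.2 hn
  have hlk : n.size ≤ n.size ^ 10 := Nat.le_self_pow (by norm_num) _
  have hlB : n.size * 262144 ≤ B := by nlinarith
  have hnB : 262144 * n ≤ B := by nlinarith
  set s₀ := input A ρ₀ ρp ρm v δ with hs₀
  have hw₀ : s₀.WordsLE B := input_wordsLE (by omega) (by omega) hnm
  refine Halts.mono (T := ((6 * n.size + 13) + (((160 * n + 15) + (((384 * n.size + 11) + ((43 +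
    (((n * (k * 18 + 26) + 5) + ((3 + (n.size ^ 10 * 262144 * n *
      (20 * n + k * (24 * (64 * n.size) + 90) + 57) + 1)) + 1)) + 1)) + 1)) + 1)) + 1)) + 1)
    ?_ (by omega) le_rfl
  refine Halts.of_step_eq_pure (by rw [optimize, step]) hw₀ ?_
  refine sizeCode_ensures (n := n) hw₀ rfl hn (by omega) E _ _ _ ?_
  rintro s₁ hw₁ ⟨hf₁, ha₁, n2, n3, r2, r3⟩
  have n0 : s₁.nat 0 = n := hf₁.nat 0 (by norm_num)
  have n1 : s₁.nat 1 = m := hf₁.nat 1 (by norm_num)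
  have r0 : s₁.real 0 = ρ₀ := hf₁.real 0 (by norm_num)
  have r1 : s₁.real 1 = δ := hf₁.real 1 (by norm_num)
  replace r3 : s₁.real 3 = 0 := r3
  refine Halts.of_step_eq_pure (by rw [step]) hw₁ ?_
  refine sqrtCode_ensures hw₁ n0 hn n2 r2 (by omega) E _ _ _ ?_
  rintro s₂ hw₂ ⟨hf₂, ha₂, hr, hr'⟩
  refine Halts.of_step_eq_pure (by rw [step]) hw₂ ?_
  refine powerCode_ensures hw₂ ((hf₂.nat 2 (by norm_num)).trans n2)
    ((hf₂.nat 3 (by norm_num)).trans n3) (by omega) (by omega) E _ _ _ ?_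
  rintro s₃ hw₃ ⟨hf₃, ha₃, n4, r10⟩
  have f₃ : Frame 4 4 s₁ s₃ := hf₂.trans hf₃.of_le
  have r4 := hf₃.real 4 (by norm_num)
  set r := s₂.real 4 with hrdef
  refine Halts.of_step_eq_pure (by rw [step]) hw₃ ?_
  refine parameterCode_ensures (A := A) hw₃ ((f₃.nat 0 (by norm_num)).trans n0) hn hl
    ((f₃.nat 1 (by norm_num)).trans n1) ((f₃.nat 2 (by norm_num)).trans n2)
    ((f₃.nat 3 (by norm_num)).trans n3) n4 ((f₃.real 0 (by norm_num)).trans r0)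
    ((f₃.real 1 (by norm_num)).trans r1) ((f₃.real 2 (by norm_num)).trans r2)
    ((f₃.real 3 (by norm_num)).trans r3) r4 r10
    (by rw [f₃.natArr, hf₁.natArr]; rfl) (by rw [f₃.natArr, hf₁.natArr]; rfl) hB hm E _ _ _ ?_
  rintro s₄ hw₄ ⟨ha₄, r0₄, r4₄, r12, g₄⟩
  have a₄ : s₄.realArr = s₀.realArr := by rw [ha₄, ha₃, ha₂, ha₁]
  refine Halts.of_step_eq_pure (by rw [step]) hw₄ ?_
  refine linearCode_ensures (ρp := ρp) (ρm := ρm) (v := v) g₄ hw₄ (by omega) hk r0₄ r4₄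
    (by rw [a₄]; rfl) (by rw [a₄]; rfl) (by rw [a₄]; rfl) (by rw [a₄]; rfl) E _ _ _ ?_
  rintro s₅ hw₅ ⟨hf₅, ha₅, hlin⟩
  have g₅ := g₄.of_frame hf₅
  refine Halts.of_step_eq_pure (by rw [step]) hw₅ ?_
  refine Ensures.block (Q := fun s' => Globals A (64 * n.size) (n.size ^ 10 * 262144 * n)
    (64 * n.size ^ 5 / r) (1 / (16384 * n.size ^ 9)) δ s' ∧
    Point A (64 * n.size) (64 * n.size ^ 5 / r) (linearTerm A ρ₀ ρp ρm v r) 0 s' ∧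
    s'.nat 8 = 0) hw₅ ?_ ?_ E _ _ _ ?_
  · simp
  · refine ⟨g₅.of_frame (L := 8) (R := 8) (by simp), ⟨?_, ?_, ?_, ?_, ?_⟩, by simp⟩
    · simp only [execs, Op.exec, State.realArr_setNat]
      rw [ha₅ 3 (by norm_num), a₄]; rfl
    · simpa using hlin
    · intro j
      simp only [execs, Op.exec, State.realArr_setNat]
      rw [ha₅ 4 (by norm_num), a₄]; rfl
    · intro j
      simp only [execs, Op.exec, State.realArr_setNat]
      rw [ha₅ 5 (by norm_num), a₄, Matrix.mulVec_zero]; rfl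
    · simp only [execs, Op.exec, State.real_setNat]
      -- At the origin all `2 * m` approximate exponentials equal `1`.
      rw [hf₅.real 12 (by norm_num), r12, approxPartition, Matrix.mulVec_zero]
      simp [approxExp]
      ring
  rintro s₆ hw₆ ⟨g₆, hx₆, n8⟩
  exact (loop_halts hA (hP r hr hr') hn hδ hδ1 (hg r hr) hy (by omega) hk
    (fun x s hx hpt hle => hE r hr hr' x s hx hpt.coords hle) _ 0 s₆ 0 (by omega) hw₆ g₆ hx₆
    (fun j => by simp) n8).mono le_rfl (hp r hr hr')

end PenalizedOptimization

/-! ### Numerical estimates for the chosen parameters. -/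

namespace PenalizedOptimization

open RealRAM SparseMatrix

variable {m n : ℕ}

theorem two_le_size (hn : 2 ≤ n) : 2 ≤ n.size := Nat.lt_size.2 (by simpa using hn)

theorem size_le_self (n : ℕ) : n.size ≤ n := Nat.size_le.2 Nat.lt_two_pow_self

theorem log_le_size (hn : 2 ≤ n) : Real.log n ≤ n.size := by
  have h1 : (n : ℝ) ≤ Real.exp n.size := by
    have h2 : (n : ℝ) ≤ 2 ^ n.size := by exact_mod_cast (Nat.lt_size_self n).le
    rw [← Real.exp_one_pow]
    refine h2.trans (pow_le_pow_left₀ (by norm_num) ?_ _)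
    linarith [Real.add_one_le_exp 1]
  have h0 : (0 : ℝ) < n := by exact_mod_cast (by omega : 0 < n)
  exact (Real.log_le_iff_le_exp h0).2 h1

/-- With `n.size = l + 1` and `l ≥ 1`, one has `l + 1 ≤ 2 * l` and `l * log 2 ≤ log n`, and `3 * log
2 > 2`. -/
theorem size_le_log (hn : 2 ≤ n) : (n.size : ℝ) ≤ 3 * Real.log n := by
  have h2 := two_le_size hn
  obtain ⟨l, hl⟩ : ∃ l, n.size = l + 1 := ⟨n.size - 1, by omega⟩
  have h3 : 2 ^ l ≤ n := Nat.lt_size.1 (by omega)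
  have h4 : (l : ℝ) * Real.log 2 ≤ Real.log n := by
    rw [← Real.log_pow]
    exact Real.log_le_log (by positivity) (by exact_mod_cast h3)
  have h5 : (1 : ℝ) ≤ l := by exact_mod_cast (by omega : 1 ≤ l)
  rw [hl]
  push_cast
  nlinarith [Real.log_two_gt_d9]

/-- Facts about the dimension `n`, its square root `q`, and its binary length `L`. -/
theorem size_facts (hn : 2 ≤ n) : (2 : ℝ) ≤ n.size ∧ 1 ≤ √(n : ℝ) ∧ √(n : ℝ) ^ 2 = n ∧
    √(n : ℝ) ≤ n ∧ (n : ℝ) ≤ 2 ^ n.size ∧ (n.size : ℝ) ≤ 2 ^ n.size ∧ (2 : ℝ) ≤ n := by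
  have h0 : (2 : ℝ) ≤ n := by exact_mod_cast hn
  refine ⟨by exact_mod_cast two_le_size hn, Real.one_le_sqrt.2 (by linarith),
    Real.sq_sqrt (by linarith), Real.sqrt_le_iff.2 ⟨by linarith, by nlinarith⟩,
    by exact_mod_cast (Nat.lt_size_self n).le, by exact_mod_cast Nat.lt_two_pow_self.le, h0⟩

/-- The scale `β ~ L ^ 5 / q` balances the smoothing error. With `α ~ L ^ (-9)` both the curvature
error `n α β` and the fluctuation error `n l α` are of order `q / L ^ 4`. The rate `l` is such that
`l * C` is of order `L`, and `2 ^ (64 * L)` exceeds every polynomial quantity that occurs. -/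
theorem parameters (hn : 2 ≤ n) {r : ℝ} (hr : √(n : ℝ) ≤ r) :
    Parameters n (64 * n.size) (64 * n.size ^ 5 / r) (1 / (16384 * n.size ^ 9))
      (√(n : ℝ) / n.size ^ 4 / (512 * n)) (4 * n.size ^ 5 / √(n : ℝ))
      (√(n : ℝ) / n.size ^ 4 / 8) := by
  obtain ⟨hL, hq1, hq2, hqn, hn2, hL2, hn'⟩ := size_facts hn
  set L : ℝ := (n.size : ℝ) with hLdef
  set q : ℝ := √(n : ℝ) with hq
  have hq0 : 0 < q := by linarith
  have hr0 : 0 < r := by linarith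
  have hL0 : 0 < L := by linarith
  set U : ℝ := 2 ^ n.size with hU
  have hU1 : 1 ≤ U := by linarith
  have hU2 : 2 ≤ U := by linarith
  have e64 : (2 : ℝ) ^ (64 * n.size) = U ^ 64 := by rw [hU, ← pow_mul, mul_comm]
  have hβ : 64 * L ^ 5 / r ≤ 64 * L ^ 5 / q := by gcongr
  have hβn : 64 * L ^ 5 / r * n ≤ 64 * L ^ 5 * q := by
    calc 64 * L ^ 5 / r * n ≤ 64 * L ^ 5 / q * n := by gcongr
      _ = 64 * L ^ 5 * q := by rw [← hq2]; field_simp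
  have hL1 : 1 ≤ L := by linarith
  have hL5 : L ^ 5 ≤ L ^ 9 := pow_le_pow_right₀ hL1 (by norm_num)
  have hL9 : 0 < L ^ 9 := by positivity
  constructor
  · positivity
  · positivity
  · rw [div_le_one (by positivity)]
    linarith [one_le_pow₀ hL1 (n := 9)]
  · rw [show 2 * (1 / (16384 * L ^ 9)) * (64 * L ^ 5 / r) = 128 * L ^ 5 / (16384 * L ^ 9 * r) by
      field_simp; norm_num, div_le_one (by positivity)]
    nlinarith
  · positivity
  · rw [show 10 * (1 / (16384 * L ^ 9)) * (4 * L ^ 5 / q) = 40 * L ^ 5 / (16384 * L ^ 9 * q) by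
      field_simp; norm_num, div_le_one (by positivity)]
    nlinarith
  · positivity
  · rw [e64]
    calc 64 * L ^ 5 / r * n ≤ 64 * L ^ 5 * q := hβn
      _ ≤ U ^ 6 * U ^ 5 * U := by
          have : (64 : ℝ) ≤ U ^ 6 := by
            have := pow_le_pow_left₀ (by norm_num) hU2 6
            linarith
          gcongr
          linarith
      _ = U ^ 12 := by ring
      _ ≤ U ^ 64 := pow_le_pow_right₀ hU1 (by norm_num)
  · rw [e64, div_le_iff₀ (by positivity), show q / L ^ 4 / (512 * n) * U ^ 64 =
      q * U ^ 64 / (L ^ 4 * (512 * n)) by field_simp, le_div_iff₀ (by positivity)]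
    have h21 : (2 : ℝ) ^ 21 ≤ U ^ 21 := pow_le_pow_left₀ (by norm_num) hU2 21
    calc (64 * L ^ 5 / r * n) ^ 2 * (L ^ 4 * (512 * n))
        ≤ (64 * L ^ 5 * q) ^ 2 * (L ^ 4 * (512 * n)) := by gcongr
      _ = 2 ^ 21 * L ^ 14 * n ^ 2 := by rw [mul_pow, hq2]; ring
      _ ≤ U ^ 21 * U ^ 14 * U ^ 2 := by gcongr
      _ = U ^ 37 := by ring
      _ ≤ U ^ 64 := pow_le_pow_right₀ hU1 (by norm_num)
      _ ≤ q * U ^ 64 := le_mul_of_one_le_left (by positivity) hq1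
  -- The three contributions are at most `1 / 64`, `1 / 64` and `400 / 16384` of `q / L ^ 4`,
  -- together less than `1 / 8`.
  · have t1 : n * (2 * (4 * (q / L ^ 4 / (512 * n)))) = q / L ^ 4 / 64 := by
      field_simp; norm_num
    have t2 : n * (4 * (1 / (16384 * L ^ 9)) * (64 * L ^ 5 / r)) ≤ q / L ^ 4 / 64 := by
      calc n * (4 * (1 / (16384 * L ^ 9)) * (64 * L ^ 5 / r))
          = 4 * (1 / (16384 * L ^ 9)) * (64 * L ^ 5 / r * n) := by ring
        _ ≤ 4 * (1 / (16384 * L ^ 9)) * (64 * L ^ 5 * q) := by gcongr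
        _ = q / L ^ 4 / 64 := by field_simp; norm_num
    have t3 : n * (100 * (4 * L ^ 5 / q) * (1 / (16384 * L ^ 9))) = q / L ^ 4 * (400 / 16384) := by
      rw [← hq2]; field_simp; norm_num
    rw [mul_add, mul_add, t1, t3]
    have : 0 < q / L ^ 4 := by positivity
    linarith

/-- The first part is at most `2`, because `|v j| ≤ ‖v‖ ≤ 2 r`; the second is at most the total
weight of `ρp` and `ρm`, hence at most `1`. -/
theorem abs_linearTerm_le {A : Matrix (Fin m) (Fin n) ℝ} (hA : ∀ i j, |A i j| ≤ 1) {ρ₀ r : ℝ}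
    {ρp ρm : Fin m → ℝ} {v : EuclideanSpace ℝ (Fin n)} (h0 : 0 ≤ ρ₀) (hp : ∀ i, 0 ≤ ρp i)
    (hm : ∀ i, 0 ≤ ρm i) (hsum : ρ₀ + ∑ i, ρp i + ∑ i, ρm i = 1) (hv : ‖v‖ ≤ 2 * √(n : ℝ))
    (hr0 : 0 < r) (hr : √(n : ℝ) ≤ r) (j : Fin n) : |linearTerm A ρ₀ ρp ρm v r j| ≤ 3 := by
  have hsp : 0 ≤ ∑ i, ρp i := Finset.sum_nonneg fun i _ => hp i
  have hsm : 0 ≤ ∑ i, ρm i := Finset.sum_nonneg fun i _ => hm i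
  have h1 : |-(ρ₀ * v.ofLp j / r)| ≤ 2 := by
    rw [abs_neg, abs_div, abs_of_pos hr0, div_le_iff₀ hr0, abs_mul, abs_of_nonneg h0]
    have h2 : |v.ofLp j| ≤ ‖v‖ := PiLp.norm_apply_le v j
    nlinarith [abs_nonneg (v.ofLp j)]
  have h2 : |∑ i, A i j * (ρp i - ρm i)| ≤ ∑ i, ρp i + ∑ i, ρm i := by
    rw [← Finset.sum_add_distrib]
    refine (Finset.abs_sum_le_sum_abs _ _).trans (Finset.sum_le_sum fun i _ => ?_)
    rw [abs_mul]
    refine (mul_le_of_le_one_left (abs_nonneg _) (hA i j)).trans ?_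
    rw [abs_le]
    constructor <;> linarith [hp i, hm i]
  rw [linearTerm]
  exact (abs_add_le _ _).trans (by linarith)

theorem linearTerm_dotProduct (A : Matrix (Fin m) (Fin n) ℝ) (ρ₀ r : ℝ) (ρp ρm : Fin m → ℝ)
    (v : EuclideanSpace ℝ (Fin n)) (x : Fin n → ℝ) :
    linearTerm A ρ₀ ρp ρm v r ⬝ᵥ x =
      -(ρ₀ * (v.ofLp ⬝ᵥ x) / r) + ρp ⬝ᵥ (A *ᵥ x) - ρm ⬝ᵥ (A *ᵥ x) := by
  have h1 : ρp ⬝ᵥ (A *ᵥ x) - ρm ⬝ᵥ (A *ᵥ x) = ∑ j, (∑ i, A i j * (ρp i - ρm i)) * x j := by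
    rw [← sub_dotProduct]
    simp only [dotProduct, Matrix.mulVec, Finset.mul_sum, Finset.sum_mul, Pi.sub_apply]
    rw [Finset.sum_comm]
    exact Finset.sum_congr rfl fun j _ => Finset.sum_congr rfl fun i _ => by ring
  rw [add_sub_assoc, h1]
  simp only [dotProduct, linearTerm, Finset.mul_sum, Finset.sum_div, ← Finset.sum_neg_distrib]
  rw [← Finset.sum_add_distrib]
  exact Finset.sum_congr rfl fun j _ => by ring

/-- The two expressions differ only by `1 / √n` against `1 / r`. The crude bound `2 * √n * n` for
`|v ⬝ᵥ x|` is swamped by the precision `n / 2 ^ (16 * n)` of `r`. -/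
theorem abs_objective_sub_le {A : Matrix (Fin m) (Fin n) ℝ} {ρ₀ r δ : ℝ}
    {ρp ρm : Fin m → ℝ} {v : EuclideanSpace ℝ (Fin n)} (hn : 2 ≤ n) (h0 : 0 ≤ ρ₀) (h1 : ρ₀ ≤ 1)
    (hv : ‖v‖ ≤ 2 * √(n : ℝ)) (hr : √(n : ℝ) ≤ r) (hr' : r ≤ √(n : ℝ) + n / 2 ^ (16 * n))
    {x : Fin n → ℝ} (hx : x ∈ cube n) :
    |objective A ρ₀ ρp ρm v δ x - (linearTerm A ρ₀ ρp ρm v r ⬝ᵥ x + δ * ‖A *ᵥ x‖)| ≤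
      √(n : ℝ) / n.size ^ 4 / 16 := by
  obtain ⟨hL, hq1, hq2, hqn, -, -, hn'⟩ := size_facts hn
  set q := √(n : ℝ) with hq
  have hq0 : 0 < q := by linarith
  have hr0 : 0 < r := by linarith
  have hvx : |v.ofLp ⬝ᵥ x| ≤ 2 * q * n := by
    rw [dotProduct]
    refine (Finset.abs_sum_le_sum_abs _ _).trans ?_
    calc ∑ j, |v.ofLp j * x j| ≤ ∑ _j : Fin n, 2 * q := Finset.sum_le_sum fun j _ => by
          rw [abs_mul]
          have h2 : |v.ofLp j| ≤ ‖v‖ := PiLp.norm_apply_le v j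
          exact (mul_le_of_le_one_right (abs_nonneg _) (abs_le.2 (hx j))).trans (h2.trans hv)
      _ = 2 * q * n := by simp; ring
  have e : objective A ρ₀ ρp ρm v δ x - (linearTerm A ρ₀ ρp ρm v r ⬝ᵥ x + δ * ‖A *ᵥ x‖) =
      -(ρ₀ * (v.ofLp ⬝ᵥ x) * ((r - q) / (q * r))) := by
    rw [linearTerm_dotProduct, objective]
    field_simp
    ring
  have hrq : 0 ≤ r - q := sub_nonneg.2 hr
  set V : ℝ := 2 ^ n with hV
  have hV1 : (n : ℝ) ≤ V := by rw [hV]; exact_mod_cast Nat.lt_two_pow_self.le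
  have hLV : (n.size : ℝ) ≤ V := le_trans (by exact_mod_cast size_le_self n) hV1
  have e16 : (2 : ℝ) ^ (16 * n) = V ^ 16 := by rw [hV, ← pow_mul, mul_comm]
  rw [e, abs_neg, abs_mul, abs_mul, abs_of_nonneg h0,
    abs_of_nonneg (div_nonneg hrq (by positivity))]
  calc ρ₀ * |v.ofLp ⬝ᵥ x| * ((r - q) / (q * r)) ≤ 1 * (2 * q * n) * ((n / V ^ 16) / (q * 1)) := by
        gcongr
        · rw [← e16]; linarith
        · linarith
    _ = 2 * n ^ 2 / V ^ 16 := by field_simp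
    _ ≤ 1 / n.size ^ 4 / 16 := by
        rw [div_div, div_le_div_iff₀ (by positivity) (by positivity)]
        have hV2 : 2 ≤ V := by linarith
        have h32 : (32 : ℝ) ≤ V ^ 5 := by
          have := pow_le_pow_left₀ (by norm_num) hV2 5
          linarith
        calc 2 * (n : ℝ) ^ 2 * (n.size ^ 4 * 16) = 32 * n ^ 2 * n.size ^ 4 := by ring
          _ ≤ V ^ 5 * V ^ 2 * V ^ 4 := by gcongr
          _ = V ^ 11 := by ring
          _ ≤ 1 * V ^ 16 := by
            rw [one_mul]; exact pow_le_pow_right₀ (by linarith) (by norm_num)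
    _ ≤ q / n.size ^ 4 / 16 := by gcongr

/-- The error budget in units of `q / L ^ 4`: `1 / 2` for optimization, `1 / 8` for smoothing, and
`1 / 16` at each of `x` and `y` for the square root. The sum is below `1`, and `log n ≤ L`. -/
theorem objective_le_of_soft_le {A : Matrix (Fin m) (Fin n) ℝ} {ρ₀ r δ : ℝ}
    {ρp ρm : Fin m → ℝ} {v : EuclideanSpace ℝ (Fin n)} (hn : 2 ≤ n) (hm : m ≤ n ^ 2)
    (h0 : 0 ≤ ρ₀) (h1 : ρ₀ ≤ 1) (hv : ‖v‖ ≤ 2 * √(n : ℝ)) (hδ : 0 ≤ δ) (hδ1 : δ ≤ 1)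
    (hr : √(n : ℝ) ≤ r) (hr' : r ≤ √(n : ℝ) + n / 2 ^ (16 * n)) {x y : Fin n → ℝ}
    (hx : x ∈ cube n) (hy : y ∈ cube n)
    (h : soft A (64 * n.size ^ 5 / r) δ (linearTerm A ρ₀ ρp ρm v r) x -
      soft A (64 * n.size ^ 5 / r) δ (linearTerm A ρ₀ ρp ρm v r) y ≤
        √(n : ℝ) / n.size ^ 4 / 2) :
    objective A ρ₀ ρp ρm v δ x ≤ objective A ρ₀ ρp ρm v δ y + √(n : ℝ) / Real.log n ^ 4 := by
  have hx' := abs_le.1 (abs_objective_sub_le (A := A) (ρp := ρp) (ρm := ρm) (δ := δ) hn h0 h1 hv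
    hr hr' hx)
  have hy' := abs_le.1 (abs_objective_sub_le (A := A) (ρp := ρp) (ρm := ρm) (δ := δ) hn h0 h1 hv
    hr hr' hy)
  obtain ⟨hL, hq1, hq2, hqn, hn2, hL2, hn'⟩ := size_facts hn
  set q := √(n : ℝ) with hq
  have hr0 : 0 < r := by linarith
  have hL0 : (0 : ℝ) < n.size := by linarith
  have hβ : 0 < 64 * (n.size : ℝ) ^ 5 / r := by positivity
  have s1 := norm_le_soft (A := A) hβ hδ (linearTerm A ρ₀ ρp ρm v r) x
  have s2 := soft_le_norm (A := A) hβ hδ (linearTerm A ρ₀ ρp ρm v r) y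
  have hlogm : Real.log (1 + 2 * m) ≤ 4 * n.size := by
    rw [Real.log_le_iff_le_exp (by positivity)]
    have hm' : (m : ℝ) ≤ n ^ 2 := by exact_mod_cast hm
    set U : ℝ := 2 ^ n.size with hU
    have hU2 : 2 ≤ U := by linarith
    have h3 : (1 : ℝ) + 2 * m ≤ U ^ 4 := by
      have a1 : (n : ℝ) ^ 2 ≤ U ^ 2 := by gcongr
      have a2 : (4 : ℝ) ≤ U ^ 2 := by nlinarith
      have a3 : 4 * U ^ 2 ≤ U ^ 2 * U ^ 2 := by gcongr
      nlinarith
    have h4 : U ≤ Real.exp n.size := by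
      rw [← Real.exp_one_pow, hU]
      exact pow_le_pow_left₀ (by norm_num) (by linarith [Real.add_one_le_exp 1]) _
    calc (1 : ℝ) + 2 * m ≤ U ^ 4 := h3
      _ ≤ Real.exp n.size ^ 4 := by gcongr
      _ = Real.exp (4 * n.size) := by rw [← Real.exp_nat_mul]; norm_num
  have hr2 : r ≤ 2 * q := by
    have : (n : ℝ) / 2 ^ (16 * n) ≤ 1 := by
      rw [div_le_one (by positivity)]
      have h5 : n ≤ 2 ^ (16 * n) := Nat.lt_two_pow_self.le.trans
        (Nat.pow_le_pow_right (by norm_num) (by omega))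
      exact_mod_cast h5
    linarith
  have s3 : δ / (64 * (n.size : ℝ) ^ 5 / r) * Real.log (1 + 2 * m) ≤ q / n.size ^ 4 / 8 := by
    have hlog0 : 0 ≤ Real.log (1 + 2 * (m : ℝ)) :=
      Real.log_nonneg (by linarith [(Nat.cast_nonneg m : (0 : ℝ) ≤ m)])
    calc δ / (64 * (n.size : ℝ) ^ 5 / r) * Real.log (1 + 2 * m)
        = δ * (r / (64 * (n.size : ℝ) ^ 5)) * Real.log (1 + 2 * m) := by field_simp
      _ ≤ 1 * (2 * q / (64 * (n.size : ℝ) ^ 5)) * (4 * n.size) := by gcongr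
      _ = q / n.size ^ 4 / 8 := by field_simp; norm_num
  have hlog : 0 < Real.log n := Real.log_pos (by linarith)
  have s4 : q / n.size ^ 4 ≤ q / Real.log n ^ 4 := by
    gcongr
    exact log_le_size hn
  have s5 : 0 < q / n.size ^ 4 := by positivity
  linarith [hx'.1, hx'.2, hy'.1, hy'.2]

/-- The initial excess is at most `4 * n`, by convexity and slopes of size at most `4`. The
contraction over all iterations makes its contribution to the exponent at most `1`, against `- 3 / 2
* L` from the gap between `D` and `C`. -/
theorem success_probability {A : Matrix (Fin m) (Fin n) ℝ} (hA : ∀ i j, |A i j| ≤ 1) {r δ : ℝ}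
    (hn : 2 ≤ n) (hδ : 0 ≤ δ) (hδ1 : δ ≤ 1) (hr : √(n : ℝ) ≤ r) {g y : Fin n → ℝ}
    (hg : ∀ j, |g j| ≤ 3) (hy : y ∈ cube n) :
    1 - 1 / (n : ℝ) ≤ 1 - Real.exp (4 * n.size ^ 5 / √(n : ℝ) *
      (1 - 1 / (16384 * n.size ^ 9) / n) ^ (n.size ^ 10 * 262144 * n) *
        (soft A (64 * n.size ^ 5 / r) δ g 0 - soft A (64 * n.size ^ 5 / r) δ g y -
          √(n : ℝ) / n.size ^ 4 / 8) - 4 * n.size ^ 5 / √(n : ℝ) *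
          (√(n : ℝ) / n.size ^ 4 / 2 - √(n : ℝ) / n.size ^ 4 / 8)) := by
  have hP := parameters hn hr
  obtain ⟨hL, hq1, hq2, hqn, hn2, hL2, hn'⟩ := size_facts hn
  have hβ := hP.scale_pos
  set q := √(n : ℝ) with hq
  set L : ℝ := (n.size : ℝ) with hLdef
  have hL0 : 0 < L := by linarith
  have hq0 : 0 < q := by linarith
  have hn0 : (0 : ℝ) < n := by linarith
  have ha : soft A (64 * L ^ 5 / r) δ g 0 - soft A (64 * L ^ 5 / r) δ g y ≤ 4 * n := by
    have h1 := soft_ge (A := A) hβ hδ g 0 y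
    have h2 : |∑ j, (y j - (0 : Fin n → ℝ) j) * slope A (64 * L ^ 5 / r) δ g 0 j| ≤ 4 * n := by
      refine (Finset.abs_sum_le_sum_abs _ _).trans ?_
      calc _ ≤ ∑ _j : Fin n, (4 : ℝ) := Finset.sum_le_sum fun j _ => by
            rw [abs_mul, Pi.zero_apply, sub_zero]
            exact (mul_le_of_le_one_left (abs_nonneg _) (abs_le.2 (hy j))).trans
              (abs_slope_le hA hδ hδ1 0 j (hg j))
        _ = 4 * n := by simp; ring
    linarith [(abs_le.1 h2).1]
  set α : ℝ := 1 / (16384 * L ^ 9) with hα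
  have hα0 : 0 < α := hP.step_pos
  have hαn : α / n ≤ 1 := by rw [div_le_one hn0]; linarith [hP.step_le]
  -- The exponent `16 * L` is `α / n` times the number of iterations, as `262144 / 16384 = 16`.
  have hexp : (1 - α / n) ^ (n.size ^ 10 * 262144 * n) ≤ Real.exp (-(16 * L)) := by
    calc (1 - α / n) ^ (n.size ^ 10 * 262144 * n)
        ≤ Real.exp (-(α / n)) ^ (n.size ^ 10 * 262144 * n) :=
          pow_le_pow_left₀ (by linarith) (by linarith [Real.add_one_le_exp (-(α / n))]) _
      _ = Real.exp (-(16 * L)) := by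
          rw [← Real.exp_nat_mul]
          congr 1
          push_cast
          rw [hα, ← hLdef]
          field_simp
          norm_num
  have hpow : 0 ≤ (1 - α / n) ^ (n.size ^ 10 * 262144 * n) := pow_nonneg (by linarith) _
  have e1 : 4 * L ^ 5 / q * (q / L ^ 4 / 2 - q / L ^ 4 / 8) = 3 / 2 * L := by
    field_simp; norm_num
  have e2 : 4 * L ^ 5 / q * (1 - α / n) ^ (n.size ^ 10 * 262144 * n) *
      (soft A (64 * L ^ 5 / r) δ g 0 - soft A (64 * L ^ 5 / r) δ g y - q / L ^ 4 / 8) ≤ 1 := by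
    have hpos : 0 < q / L ^ 4 := by positivity
    set U : ℝ := 2 ^ n.size with hU
    have hU2 : 2 ≤ U := by linarith
    have hUe : U ^ 16 ≤ Real.exp (16 * L) := by
      have h4 : U ≤ Real.exp L := by
        rw [hLdef, ← Real.exp_one_pow, hU]
        exact pow_le_pow_left₀ (by norm_num) (by linarith [Real.add_one_le_exp 1]) _
      calc U ^ 16 ≤ Real.exp L ^ 16 := by gcongr
        _ = Real.exp (16 * L) := by rw [← Real.exp_nat_mul]; norm_num
    calc _ ≤ 4 * L ^ 5 / 1 * Real.exp (-(16 * L)) * (4 * n) := by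
          refine (mul_le_mul_of_nonneg_left (by linarith : _ ≤ 4 * (n : ℝ)) (by positivity)).trans ?_
          gcongr
      _ = 16 * L ^ 5 * n / Real.exp (16 * L) := by rw [Real.exp_neg]; field_simp; norm_num
      _ ≤ 1 := by
          rw [div_le_one (Real.exp_pos _)]
          refine le_trans ?_ hUe
          have h16 : (16 : ℝ) ≤ U ^ 4 := by
            have := pow_le_pow_left₀ (by norm_num) hU2 4
            linarith
          calc 16 * L ^ 5 * n ≤ U ^ 4 * U ^ 5 * U := by gcongr
            _ = U ^ 10 := by ring
            _ ≤ U ^ 16 := pow_le_pow_right₀ (by linarith) (by norm_num)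
  have e3 : Real.exp (-L) ≤ 1 / n := by
    rw [Real.exp_neg, inv_eq_one_div]
    have : (n : ℝ) ≤ Real.exp L := by
      rw [← Real.log_le_iff_le_exp hn0]; exact log_le_size hn
    gcongr
  -- Since `L ≥ 2`, the exponent is at most `1 - 3 / 2 * L ≤ -L`.
  refine sub_le_sub_left (le_trans (Real.exp_le_exp.2 ?_) e3) _
  rw [e1]
  linarith

theorem exists_isLeast_objective (A : Matrix (Fin m) (Fin n) ℝ) (ρ₀ : ℝ) (ρp ρm : Fin m → ℝ)
    (v : EuclideanSpace ℝ (Fin n)) (δ : ℝ) :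
    ∃ y ∈ cube n, IsLeast (objective A ρ₀ ρp ρm v δ '' cube n) (objective A ρ₀ ρp ρm v δ y) := by
  have hc : IsCompact (cube n) := by
    have : cube n = Set.univ.pi fun _ => Set.Icc (-1 : ℝ) 1 := by
      ext x; simp only [cube, Set.mem_ofPred_eq, Set.mem_univ_pi]
    rw [this]
    exact isCompact_univ_pi fun _ => isCompact_Icc
  have hA : Continuous fun x : Fin n → ℝ => A *ᵥ x := continuous_const.matrix_mulVec continuous_id
  have hdot : ∀ {d : ℕ} (w : Fin d → ℝ), Continuous fun x : Fin d → ℝ => w ⬝ᵥ x := fun w =>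
    continuous_const.dotProduct continuous_id
  have hcont : Continuous (objective A ρ₀ ρp ρm v δ) := by
    unfold objective
    exact (((continuous_const.mul (hdot _)).div_const _).add ((hdot _).comp hA)).sub
      ((hdot _).comp hA) |>.add (continuous_const.mul hA.norm)
  obtain ⟨y, hy, hmin⟩ := hc.exists_isMinOn ⟨0, fun j => by simp⟩ hcont.continuousOn
  refine ⟨y, hy, ⟨y, hy, rfl⟩, ?_⟩
  rintro _ ⟨x, hx, rfl⟩
  exact hmin hx

/-- The main loop dominates: ten factors `L` come from the number of iterations and one from the
squarings in each exponential. Passing from `L` to `3 * log n` produces `3 ^ 11`. -/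
theorem time_bound {k : ℕ} (hn : 2 ≤ n) :
    ((390 * n.size + 160 * n + n * (k * 18 + 26) + 102 +
        n.size ^ 10 * 262144 * n * (20 * n + k * (24 * (64 * n.size) + 90) + 57) : ℕ) : ℝ) ≤
      (430000000 * 3 ^ 11) * ((k : ℝ) * n + (n : ℝ) ^ 2) * Real.log n ^ 11 := by
  have hL1 : 1 ≤ n.size := by have := two_le_size hn; omega
  have hLn := size_le_self n
  have key : 390 * n.size + 160 * n + n * (k * 18 + 26) + 102 +
        n.size ^ 10 * 262144 * n * (20 * n + k * (24 * (64 * n.size) + 90) + 57) ≤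
      430000000 * (k * n + n ^ 2) * n.size ^ 11 := by
    set L := n.size
    have hP1 : 1 ≤ L ^ 11 := Nat.one_le_pow _ _ hL1
    have h1 : n ≤ n ^ 2 := Nat.le_self_pow (by norm_num) _
    have h2 : 390 * L + 160 * n + n * (k * 18 + 26) + 102 ≤ 1000 * (k * n + n ^ 2) := by nlinarith
    -- The constant is `1626 = 24 * 64 + 90`.
    have h3 : n * (20 * n + k * (24 * (64 * L) + 90) + 57) ≤ 1626 * (k * n + n ^ 2) * L := by
      have a1 : n ^ 2 ≤ n ^ 2 * L := Nat.le_mul_of_pos_right _ hL1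
      have a2 : k * n ≤ k * n * L := Nat.le_mul_of_pos_right _ hL1
      nlinarith
    calc _ ≤ 1000 * (k * n + n ^ 2) + L ^ 10 * 262144 * (1626 * (k * n + n ^ 2) * L) := by
          rw [mul_assoc (L ^ 10 * 262144) n]
          exact add_le_add h2 (Nat.mul_le_mul_left _ h3)
      _ = 1000 * (k * n + n ^ 2) * 1 + 426246144 * (k * n + n ^ 2) * L ^ 11 := by ring
      _ ≤ 1000 * (k * n + n ^ 2) * L ^ 11 + 426246144 * (k * n + n ^ 2) * L ^ 11 := by gcongr
      _ ≤ 430000000 * (k * n + n ^ 2) * L ^ 11 := by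
        rw [← add_mul, ← add_mul]
        gcongr
        norm_num
  calc _ ≤ ((430000000 * (k * n + n ^ 2) * n.size ^ 11 : ℕ) : ℝ) := Nat.cast_le.2 key
    _ = 430000000 * ((k : ℝ) * n + (n : ℝ) ^ 2) * (n.size : ℝ) ^ 11 := by push_cast; ring
    _ ≤ 430000000 * ((k : ℝ) * n + (n : ℝ) ^ 2) * (3 * Real.log n) ^ 11 := by
        gcongr
        exact size_le_log hn
    _ = _ := by rw [mul_pow]; ring

end PenalizedOptimization

/-! ### Assembly of the main theorem. -/

theorem proposition4p2 :
    ∃ (P : RealRAM.Program) (C : ℝ) (b c : ℕ),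
      ∀ (m n k : ℕ), 2 ≤ n → m ≤ n ^ 2 →
      ∀ (A : Matrix (Fin m) (Fin n) ℝ) (ρ₀ : ℝ) (ρp ρm : Fin m → ℝ)
        (v : EuclideanSpace ℝ (Fin n)) (δ : ℝ),
        (∀ i j, |A i j| ≤ 1) →
        (∀ j, {i | A i j ≠ 0}.ncard ≤ k) →
        0 ≤ ρ₀ → (∀ i, 0 ≤ ρp i) → (∀ i, 0 ≤ ρm i) →
        ρ₀ + ∑ i, ρp i + ∑ i, ρm i = 1 →
        ‖v‖ ≤ 2 * √(n : ℝ) →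
        δ ∈ Set.Ioo (0 : ℝ) 1 →
        ∃ (T : ℕ) (opt : ℝ),
          (T : ℝ) ≤ C * ((k : ℝ) * n + (n : ℝ) ^ 2) * Real.log n ^ c ∧
          RealRAM.HaltsWithin P (PenalizedOptimization.input A ρ₀ ρp ρm v δ) T ∧
          RealRAM.UsesWordsLE P (PenalizedOptimization.input A ρ₀ ρp ρm v δ) (n ^ b) ∧
          IsLeast (PenalizedOptimization.objective A ρ₀ ρp ρm v δ ''
            PenalizedOptimization.cube n) opt ∧
          ENNReal.ofReal (1 - 1 / (n : ℝ)) ≤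
            RealRAM.haltProb P (PenalizedOptimization.input A ρ₀ ρp ρm v δ) T (fun s =>
              PenalizedOptimization.output n s ∈ PenalizedOptimization.cube n ∧
              PenalizedOptimization.objective A ρ₀ ρp ρm v δ
                  (PenalizedOptimization.output n s) ≤
                opt + √(n : ℝ) / Real.log n ^ 4) := by
  -- The word bound `n ^ 29` covers the iteration count `L ^ 10 * 2 ^ 18 * n`, because `L ≤ n` and
  -- `2 ≤ n`.
  refine ⟨PenalizedOptimization.optimize, 430000000 * 3 ^ 11, 29, 11, ?_⟩
  intro m n k hn hm A ρ₀ ρp ρm v δ hA hk h0 hp hmn hsum hv hδ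
  obtain ⟨y, hy, hleast⟩ := PenalizedOptimization.exists_isLeast_objective A ρ₀ ρp ρm v δ
  have hL := PenalizedOptimization.size_le_self n
  have hρ : ρ₀ ≤ 1 := by
    have := Finset.sum_nonneg fun i (_ : i ∈ Finset.univ) => hp i
    have := Finset.sum_nonneg fun i (_ : i ∈ Finset.univ) => hmn i
    linarith
  have hq := (PenalizedOptimization.size_facts hn).2.1
  have hg : ∀ r, √(n : ℝ) ≤ r → ∀ j,
      |PenalizedOptimization.linearTerm A ρ₀ ρp ρm v r j| ≤ 3 := fun r hr =>
    PenalizedOptimization.abs_linearTerm_le hA h0 hp hmn hsum hv (by linarith) hr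
  have hpow : ∀ i, i ≤ 29 → n ^ i ≤ n ^ 29 := fun i hi => Nat.pow_le_pow_right (by omega) hi
  have main := PenalizedOptimization.optimize_halts (B := n ^ 29)
    (E := fun s => PenalizedOptimization.output n s ∈ PenalizedOptimization.cube n ∧
      PenalizedOptimization.objective A ρ₀ ρp ρm v δ (PenalizedOptimization.output n s) ≤
        PenalizedOptimization.objective A ρ₀ ρp ρm v δ y + √(n : ℝ) / Real.log n ^ 4)
    (p := 1 - 1 / (n : ℝ)) hA (by omega) hδ.1.le hδ.2.le
    (fun j => SparseMatrix.column_length_le A j (hk j))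
    (fun r hr _ => PenalizedOptimization.parameters hn hr) hy hg ?_ ?_ ?_ ?_
    (fun r hr _ => PenalizedOptimization.success_probability hA hn hδ.1.le hδ.2.le hr
      (hg r hr) hy)
  · exact ⟨_, _, PenalizedOptimization.time_bound hn, main.halt, main.words, hleast, main.prob⟩
  · calc n.size ^ 10 * 262144 * n = n.size ^ 10 * 2 ^ 18 * n := by norm_num
      _ ≤ n ^ 10 * n ^ 18 * n := by gcongr
      _ = n ^ 29 := by ring
  · refine le_trans ?_ (hpow 4 (by norm_num))
    have h4 : 4 ≤ n ^ 2 := by nlinarith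
    calc 2 * m + 1 ≤ 4 * n ^ 2 := by omega
      _ ≤ n ^ 2 * n ^ 2 := Nat.mul_le_mul_right _ h4
      _ = n ^ 4 := by ring
  · refine le_trans (Nat.mul_le_mul_left n hm) (le_trans (le_of_eq ?_) (hpow 3 (by norm_num)))
    ring
  · intro r hr hr' x s hx hs hle
    have e : PenalizedOptimization.output n s = x := funext hs
    rw [e]
    exact ⟨hx, PenalizedOptimization.objective_le_of_soft_le hn hm h0 hρ hv hδ.1.le hδ.2.le hr hr'
      hx hy hle⟩
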